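/- Let $F=\mathbb F_8$ be the field with eight elements and let $z\in F$ satisfy $z^3=z+1$ (so $z$ generates $F^\times$). Let $G=\mathrm{SL}(2,8)=\mathrm{SL}(2,F)$, and for $B\subseteq G$, $h\in G$ write $Bh=\{bh\mid b\in B\}$ and $B^h=h^{-1}Bh$. Write $[a,b;c,d]$ for the matrix with rows $(a,b)$ and $(c,d)$. For a subgroup $S\le G$ of order $9$ and a set $\mathcal D$ of $9$-element subsets of $G$, each containing $1$, let $\mathbb U_{S,\mathcal D}$ be the incidence structure with point set $G$ whose blocks are all sets $Sg$, $Tg$ and $Dg$, where $g\in G$, $T$ is a Sylow $2$-subgroup of $G$ and $D\in\mathcal D$; incidence is containment. It is called an affine $\mathrm{SL}(2,8)$-unital if (Q) for each $D\in\mathcal D$ the map $(x,y)\mapsto xy^{-1}$ is injective on the pairs of distinct elements of $D$, and (P) the sets $S\smallsetminus\{1\}$, $T\smallsetminus\{1\}$ ($T$ a Sylow $2$-subgroup) and $D^*=\{xy^{-1}\mid x,y\in D,\ x\ne y\}$ ($D\in\mathcal D$) form a partition of $G\smallsetminus\{1\}$. An isomorphism is a bijection of the point sets that maps the block set onto the block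 set; an automorphism is an isomorphism of an incidence structure onto itself. Let $g=[z^2,z^4;z^4,z]$, $f=[0,1;1,0]$, $C=\langle g\rangle$, and $$D_1=\{1,\ [z^5,1;z^5,z^6],\ [z^4,z^2;1,z^2],\ [1,z;z^6,0],\ [0,z;z^6,z^2],\ [1,z^4;z^2,z^2],\ [z^3,z^5;z^3,1],\ [z^5,z^4;z^2,z^4],\ [z^2,0;0,z^5]\},$$ $$D_4=\{1,\ [z^5,0;z^6,z^2],\ [z,z^6;z^4,1],\ [z^5,z^2;z^5,0],\ [z^3,z^4;z^6,z^5],\ [1,1;z^3,z],\ [1,z;1,z^3],\ [z,z^2;1,z^5],\ [z,0;z,z^6]\}.$$ Put $D_4'=D_4^f$ and $$\mathcal D=\{D_1,D_1^g,D_1^{g^2},D_4,D_4^g,D_4^{g^2}\},\qquad \mathcal D'=\{D_1,D_1^g,D_1^{g^2},D_4',(D_4')^g,(D_4')^{g^2}\}.$$ The Osterunital is $\mathbb{OU}=\mathbb U_{C,\mathcal D}$ and the Pfingstunital is $\mathbb{PU}=\mathbb U_{C,\mathcal D'}$. Proposition. $\mathbb{OU}$ and $\mathbb{PU}$ are affine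 $\mathrm{SL}(2,8)$-unitals. There is no isomorphism between $\mathbb{OU}$ and $\mathbb{PU}$, although they have the same full automorphism group: $\mathrm{Aut}(\mathbb{OU})=\mathrm{Aut}(\mathbb{PU})$ as groups of permutations of the common point set $\mathrm{SL}(2,8)$. -/

import Mathlib

open scoped MatrixGroups

/-- An incidence structure on the point set `P` whose blocks are sets of points and whose
incidence relation is containment. -/
structure IncidenceStructure (P : Type*) where
  /-- the blocks -/
  blocks : Set (Set P)

namespace IncidenceStructure

/-- A bijection of the point sets is an isomorphism if it maps the block set of `U` onto the
block set of `V`. -/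
def IsIsomorphism {P Q : Type*} (U : IncidenceStructure P) (V : IncidenceStructure Q)
    (ψ : P ≃ Q) : Prop :=
  (fun b : Set P => ψ '' b) '' U.blocks = V.blocks

/-- Two incidence structures are isomorphic. -/
def Isomorphic {P Q : Type*} (U : IncidenceStructure P) (V : IncidenceStructure Q) : Prop :=
  ∃ ψ : P ≃ Q, U.IsIsomorphism V ψ

theorem isIsomorphism_iff {P Q : Type*} (U : IncidenceStructure P) (V : IncidenceStructure Q)
    (ψ : P ≃ Q) : U.IsIsomorphism V ψ ↔ ∀ b : Set P, b ∈ U.blocks ↔ ψ '' b ∈ V.blocks := by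
  have hinj : Function.Injective (fun b : Set P => ψ '' b) := ψ.injective.image_injective
  constructor
  · intro h b
    rw [← h]
    exact (hinj.mem_set_image (s := U.blocks) (a := b)).symm
  · intro h
    ext c
    constructor
    · rintro ⟨b, hb, rfl⟩
      exact (h b).1 hb
    · intro hc
      have hc' : ψ '' (ψ.symm '' c) = c := by simp [Set.image_image]
      exact ⟨ψ.symm '' c, (h _).2 (by rw [hc']; exact hc), hc'⟩

/-- The full automorphism group of an incidence structure, as a group of permutations of the
point set. -/
def Aut {P : Type*} (U : IncidenceStructure P) : Subgroup (Equiv.Perm P) where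
  carrier := {ψ | U.IsIsomorphism U ψ}
  one_mem' := by
    rw [Set.mem_ofPred_eq, isIsomorphism_iff]
    intro b
    simp
  mul_mem' := by
    intro ψ χ hψ hχ
    rw [Set.mem_ofPred_eq, isIsomorphism_iff] at *
    intro b
    have h : (ψ * χ : Equiv.Perm P) '' b = ψ '' (χ '' b) := by
      simp [Set.image_image]
    rw [h, hχ b, hψ (χ '' b)]
  inv_mem' := by
    intro ψ hψ
    rw [Set.mem_ofPred_eq, isIsomorphism_iff] at *
    intro b
    have h : ψ '' ((ψ⁻¹ : Equiv.Perm P) '' b) = b := by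
      simp [Set.image_image]
    rw [hψ ((ψ⁻¹ : Equiv.Perm P) '' b), h]

end IncidenceStructure

namespace AffineSL2

/-- The right translate `B g`. -/
def rightTranslate {G : Type*} [Group G] (B : Set G) (g : G) : Set G :=
  (fun x => x * g) '' B

/-- The conjugate `B ^ h = h⁻¹ B h`. -/
def conj {G : Type*} [Group G] (B : Set G) (h : G) : Set G :=
  (fun x => h⁻¹ * x * h) '' B

/-- The set `D* = {x y⁻¹ | x, y ∈ D, x ≠ y}`. -/
def star {G : Type*} [Group G] (D : Set G) : Set G :=
  {w | ∃ x ∈ D, ∃ y ∈ D, x ≠ y ∧ w = x * y⁻¹}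

/-- The incidence structure `𝕌_{S,𝒟}` with point set `SL(2,F)`, `F` a finite field of
characteristic `p`. Its blocks are the right translates of `S`, of the Sylow `p`-subgroups
(that is, of the conjugates of one of them) and of the members of `𝒟`. -/
def unital {F : Type*} [Field F] (p : ℕ) (S : Subgroup SL(2, F)) (𝒟 : Set (Set SL(2, F))) :
    IncidenceStructure SL(2, F) where
  blocks := {b | ∃ g : SL(2, F),
    b = rightTranslate (S : Set SL(2, F)) g ∨
    (∃ T : Sylow p SL(2, F), b = rightTranslate (T : Set SL(2, F)) g) ∨
    (∃ D ∈ 𝒟, b = rightTranslate D g)}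

/-- The family consisting of `S ∖ {1}`, of all `T ∖ {1}` with `T` a Sylow `p`-subgroup, and of
all `D*` with `D ∈ 𝒟`. -/
def parts {G : Type*} [Group G] (p : ℕ) (S : Subgroup G) (𝒟 : Set (Set G)) :
    Unit ⊕ Sylow p G ⊕ 𝒟 → Set G
  | .inl _ => (S : Set G) \ {1}
  | .inr (.inl T) => (T : Set G) \ {1}
  | .inr (.inr D) => star (D : Set G)

/-- The conditions on `S` and `𝒟` under which `𝕌_{S,𝒟}` is called an affine `SL(2,q)`-unital,
where `F` is the field of order `q`, a power of the prime `p`. -/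
structure IsAffineUnital {F : Type*} [Field F] (p : ℕ) (S : Subgroup SL(2, F))
    (𝒟 : Set (Set SL(2, F))) : Prop where
  /-- `S` has order `q + 1`. -/
  card_S : Nat.card S = Nat.card F + 1
  /-- Each `D ∈ 𝒟` contains `1`. -/
  one_mem : ∀ D ∈ 𝒟, (1 : SL(2, F)) ∈ D
  /-- Each `D ∈ 𝒟` has `q + 1` elements. -/
  card_D : ∀ D ∈ 𝒟, D.ncard = Nat.card F + 1
  /-- Condition (Q): `(x, y) ↦ x y⁻¹` is injective on the pairs of distinct elements of `D`. -/
  injOn : ∀ D ∈ 𝒟, Set.InjOn (fun w : SL(2, F) × SL(2, F) => w.1 * w.2⁻¹) D.offDiag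
  /-- Condition (P): the parts are nonempty, ... -/
  parts_nonempty : ∀ i, (parts p S 𝒟 i).Nonempty
  /-- ... pairwise disjoint, ... -/
  parts_disjoint : Pairwise fun i j => Disjoint (parts p S 𝒟 i) (parts p S 𝒟 j)
  /-- ... and they cover exactly `SL(2,F) ∖ {1}`. -/
  parts_cover : ⋃ i, parts p S 𝒟 i = {1}ᶜ

/-! ### The two unitals of order 8

`F` is a field of characteristic 2 and `z ∈ F` satisfies `z ^ 3 = z + 1`. -/

/-- The elements of `SL(2,F)` whose matrices belong to `X`. -/
def ofMatrices {F : Type*} [Field F] (X : Set (Matrix (Fin 2) (Fin 2) F)) : Set SL(2, F) :=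
  {A | (A : Matrix (Fin 2) (Fin 2) F) ∈ X}

/-- The generator `g` of the cyclic group `C`. -/
def g {F : Type*} [Field F] [CharP F 2] (z : F) (hz : z ^ 3 = z + 1) : SL(2, F) :=
  ⟨!![z ^ 2, z ^ 4; z ^ 4, z], by
    have h2 : (2 : F) = 0 := CharTwo.two_eq_zero
    rw [Matrix.det_fin_two_of]
    linear_combination (-z ^ 5 - z ^ 3 - z ^ 2 - z - 1) * hz + (-z ^ 2 - z - 1) * h2⟩

/-- The involution `f`. -/
def f (F : Type*) [Field F] [CharP F 2] : SL(2, F) :=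
  ⟨!![0, 1; 1, 0], by
    have h2 : (2 : F) = 0 := CharTwo.two_eq_zero
    rw [Matrix.det_fin_two_of]
    linear_combination -h2⟩

/-- The cyclic group `C` generated by `g`. -/
def C {F : Type*} [Field F] [CharP F 2] (z : F) (hz : z ^ 3 = z + 1) : Subgroup SL(2, F) :=
  Subgroup.zpowers (g z hz)

/-- The arcuate block `D₁`. -/
def D₁ {F : Type*} [Field F] (z : F) : Set SL(2, F) :=
  ofMatrices {1,
    !![z ^ 5, 1; z ^ 5, z ^ 6],
    !![z ^ 4, z ^ 2; 1, z ^ 2],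
    !![1, z; z ^ 6, 0],
    !![0, z; z ^ 6, z ^ 2],
    !![1, z ^ 4; z ^ 2, z ^ 2],
    !![z ^ 3, z ^ 5; z ^ 3, 1],
    !![z ^ 5, z ^ 4; z ^ 2, z ^ 4],
    !![z ^ 2, 0; 0, z ^ 5]}

/-- The arcuate block `D₄`. -/
def D₄ {F : Type*} [Field F] (z : F) : Set SL(2, F) :=
  ofMatrices {1,
    !![z ^ 5, 0; z ^ 6, z ^ 2],
    !![z, z ^ 6; z ^ 4, 1],
    !![z ^ 5, z ^ 2; z ^ 5, 0],
    !![z ^ 3, z ^ 4; z ^ 6, z ^ 5],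
    !![1, 1; z ^ 3, z],
    !![1, z; 1, z ^ 3],
    !![z, z ^ 2; 1, z ^ 5],
    !![z, 0; z, z ^ 6]}

/-- The set of arcuate blocks through `1` chosen for the Osterunital. -/
def 𝒟O {F : Type*} [Field F] [CharP F 2] (z : F) (hz : z ^ 3 = z + 1) : Set (Set SL(2, F)) :=
  {D₁ z, conj (D₁ z) (g z hz), conj (D₁ z) (g z hz ^ 2),
    D₄ z, conj (D₄ z) (g z hz), conj (D₄ z) (g z hz ^ 2)}

/-- The arcuate block `D₄' = D₄ ^ f`. -/
def D₄' {F : Type*} [Field F] [CharP F 2] (z : F) : Set SL(2, F) :=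
  conj (D₄ z) (f F)

/-- The set of arcuate blocks through `1` chosen for the Pfingstunital. -/
def 𝒟P {F : Type*} [Field F] [CharP F 2] (z : F) (hz : z ^ 3 = z + 1) : Set (Set SL(2, F)) :=
  {D₁ z, conj (D₁ z) (g z hz), conj (D₁ z) (g z hz ^ 2),
    D₄' z, conj (D₄' z) (g z hz), conj (D₄' z) (g z hz ^ 2)}

/-- The Osterunital. -/
def OU {F : Type*} [Field F] [CharP F 2] (z : F) (hz : z ^ 3 = z + 1) :
    IncidenceStructure SL(2, F) :=
  unital 2 (C z hz) (𝒟O z hz)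

/-- The Pfingstunital. -/
def PU {F : Type*} [Field F] [CharP F 2] (z : F) (hz : z ^ 3 = z + 1) :
    IncidenceStructure SL(2, F) :=
  unital 2 (C z hz) (𝒟P z hz)

end AffineSL2

/-! That both structures are affine unitals is a finite computation. Over `F = F_8` there are 504 -
64 = 440 elements of nonzero trace. The 8 nontrivial elements of `C` and the 6 · 72 quotients from
the arcuate blocks are pairwise distinct and exhaust these 440. The elements of trace zero are `1`
and the involutions, which the Sylow 2-subgroups partition.

For isomorphisms, the Sylow blocks are the only ones whose size is not 9, so an isomorphism
preserves `Perp x y` (`x y⁻¹` has trace zero), the relation of lying on a common Sylow block. For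
distinct orthogonal `x`, `y`, the elements orthogonal to both form an affine line on the quadric
`det = 1`. An element `w` satisfies `w A = x A`, where `A` is the common point with `x A = y A`,
exactly when it is orthogonal to all or to none of this line. Hence a permutation preserving `Perp`
permutes the classes `{w | w A = B}`. Two such classes meet exactly when `A = A' ↔ B = B'`, so the
classes form a square grid. If `1` is fixed, the diagonal is preserved, and the map of the grid is
induced by one map of the projective line, possibly with the coordinates interchanged. The
permutation is therefore an automorphism or an antiautomorphism of the group (`exists_line_map`,
`map_mul_or_map_mul_rev`).

Condition (Q) forces an isomorphism fixing `1` to map `C` to `C`. The Frobenius map and conjugation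
by `f` realize all automorphisms of the cyclic group `C`, and an automorphism centralizing `C`,
which is transitive on the projective line, is conjugation by an element of `C`. Since the Frobenius
map and conjugation by `g` preserve both unitals, only `1`, conjugation by `f`, inversion and their
product remain as representatives (`exists_decomposition`). The last three map `D₁` to a non-block
of either unital. So every isomorphism between any two of the unitals is an automorphism of both.
This gives equal automorphism groups, and an isomorphism from one to the other would make the block
sets equal, although `D₄` is not a block of the Pfingstunital. -/

namespace AffineSL2

open Matrix Matrix.SpecialLinearGroup

/-! ### Trace zero and orthogonality -/

section Trace

variable {F : Type*} [Field F]

/-- The trace of a unimodular matrix. -/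
def tr (x : SL(2, F)) : F := Matrix.trace x.1

theorem tr_def (x : SL(2, F)) : tr x = x 0 0 + x 1 1 := trace_fin_two _

theorem trace_mul_comm (x y : SL(2, F)) : tr (x * y) = tr (y * x) := by
  simp only [tr, coe_mul]
  exact Matrix.trace_mul_comm _ _

theorem trace_inv (x : SL(2, F)) : tr (x⁻¹) = tr x := by
  simp [tr_def, coe_inv, adjugate_fin_two, add_comm]

theorem trace_conj (h x : SL(2, F)) : tr (h⁻¹ * x * h) = tr x := by
  rw [trace_mul_comm, mul_inv_cancel_left]

theorem det_entries (x : SL(2, F)) : x 0 0 * x 1 1 - x 0 1 * x 1 0 = 1 := by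
  rw [← det_fin_two, x.det_coe]

/-- The orthogonality relation of the polar form of the determinant. -/
def Perp (x y : SL(2, F)) : Prop := tr (x * y⁻¹) = 0

theorem Perp.symm {x y : SL(2, F)} (h : Perp x y) : Perp y x := by
  unfold Perp at *
  rw [← trace_inv]
  simpa using h

theorem perp_mul_right (x y a : SL(2, F)) : Perp (x * a) (y * a) ↔ Perp x y := by
  unfold Perp
  rw [_root_.mul_inv_rev, mul_assoc, mul_inv_cancel_left]

theorem perp_inv (x y : SL(2, F)) : Perp x⁻¹ y⁻¹ ↔ Perp x y := by
  unfold Perp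
  rw [← trace_inv (x * y⁻¹), trace_mul_comm]
  simp

theorem perp_map (e : SL(2, F) ≃* SL(2, F)) (he : ∀ x, tr (e x) = 0 ↔ tr x = 0)
    (x y : SL(2, F)) : Perp (e x) (e y) ↔ Perp x y := by
  unfold Perp
  rw [← map_inv, ← map_mul, he]

end Trace

section CharTwo

variable {F : Type*} [Field F] [CharP F 2]

theorem perp_self (x : SL(2, F)) : Perp x x := by
  have h2 : (2 : F) = 0 := CharTwo.two_eq_zero
  unfold Perp
  rw [mul_inv_cancel, tr_def]
  simp only [coe_one, one_apply_eq]
  linear_combination h2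

theorem entry_eq_of_trace_eq_zero {t : SL(2, F)} (ht : tr t = 0) : t 1 1 = t 0 0 := by
  rw [tr_def] at ht
  have h2 : (2 : F) = 0 := CharTwo.two_eq_zero
  linear_combination ht - t 0 0 * h2

theorem inv_eq_self_of_trace_eq_zero {t : SL(2, F)} (ht : tr t = 0) : t⁻¹ = t := by
  have h := entry_eq_of_trace_eq_zero ht
  ext i j
  fin_cases i <;> fin_cases j <;> simp [coe_inv, adjugate_fin_two, h, CharTwo.neg_eq]

/-- In characteristic 2 the adjugate merely interchanges the diagonal entries, so trace zero means
`t⁻¹ = t`. -/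
theorem trace_eq_zero_iff_sq (t : SL(2, F)) : tr t = 0 ↔ t ^ 2 = 1 := by
  constructor
  · intro ht
    rw [sq]
    nth_rw 1 [← inv_eq_self_of_trace_eq_zero ht]
    simp
  · intro ht
    have h1 : t⁻¹ = t := inv_eq_of_mul_eq_one_left (by rw [← sq, ht])
    have h : t⁻¹ 0 0 = t 0 0 := by rw [h1]
    simp only [coe_inv, adjugate_fin_two, of_apply, cons_val_zero,
      cons_val', cons_val_fin_one] at h
    rw [tr_def, h]
    exact CharTwo.add_self_eq_zero _

/-- The points of the line joining `1` and an involution. -/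
theorem exists_coeff_of_trace_eq_zero {t u : SL(2, F)} (ht : tr t = 0) (ht1 : t ≠ 1)
    (hu : tr u = 0) (htu : Perp u t) :
    ∃ s : F, u.1 = s • t.1 + (1 + s) • (1 : Matrix (Fin 2) (Fin 2) F) := by
  have h2 : (2 : F) = 0 := CharTwo.two_eq_zero
  unfold Perp at htu
  rw [inv_eq_self_of_trace_eq_zero ht] at htu
  have ht' := entry_eq_of_trace_eq_zero ht
  have hu' := entry_eq_of_trace_eq_zero hu
  have dt := det_entries t
  have du := det_entries u
  rw [tr_def, coe_mul, mul_apply, mul_apply, Fin.sum_univ_two, Fin.sum_univ_two] at htu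
  rw [ht', hu'] at htu
  rw [ht'] at dt
  rw [hu'] at du
  -- In `tr (u t)` the diagonal products occur twice and cancel; what remains says that the
  -- off-diagonal parts of `u` and `t` are proportional.
  have key : u 0 1 * t 1 0 = u 1 0 * t 0 1 := by
    linear_combination htu - (u 0 0 * t 0 0 + u 1 0 * t 0 1) * h2
  by_cases hb : t 0 1 = 0
  · have ha : t 0 0 = 1 := by
      rw [hb] at dt
      refine CharTwo.sq_injective ?_
      simp only
      linear_combination dt
    have hc : t 1 0 ≠ 0 := by
      intro hc
      apply ht1
      ext i j
      fin_cases i <;> fin_cases j <;> simp [ha, hb, hc, ht']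
    have hq : u 0 1 = 0 := by
      rw [hb, mul_zero] at key
      exact (mul_eq_zero.1 key).resolve_right hc
    have hp : u 0 0 = 1 := by
      rw [hq] at du
      refine CharTwo.sq_injective ?_
      simp only
      linear_combination du
    refine ⟨u 1 0 / t 1 0, ?_⟩
    ext i j
    fin_cases i <;> fin_cases j <;> simp [ha, hb, ht', hu', hp, hq, hc]
    · linear_combination - (u 1 0 / t 1 0) * h2
    · linear_combination - (u 1 0 / t 1 0) * h2
  -- The ratio of the off-diagonal entries must be the parameter. Squaring is injective, and the
  -- determinants express the squares of the diagonal entries by the off-diagonal ones.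
  · have hp : u 0 0 = u 0 1 / t 0 1 * t 0 0 + (1 + u 0 1 / t 0 1) := by
      refine CharTwo.sq_injective ?_
      simp only
      field_simp
      linear_combination t 0 1 ^ 2 * du + t 0 1 * u 0 1 * (- key) - u 0 1 ^ 2 * dt +
        (- u 0 1 * t 0 1 - t 0 0 * (u 0 1 * t 0 1 + u 0 1 ^ 2)
          - u 0 1 ^ 2) * h2
    refine ⟨u 0 1 / t 0 1, ?_⟩
    ext i j
    fin_cases i <;> fin_cases j <;> simp [ht', hu', hb, ← hp]
    field_simp
    linear_combination -key

end CharTwo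

end AffineSL2

/-! ### The action on the projective line and the classes `{w | w A = B}` -/

namespace AffineSL2

open Matrix Matrix.SpecialLinearGroup
open scoped LinearAlgebra.Projectivization

section Line

variable {F : Type*} [Field F]

/-- The projective line. -/
abbrev Line (F : Type*) [Field F] := ℙ F (Fin 2 → F)

/-- The point of the projective line spanned by the first unit vector. -/
def lineInfty (F : Type*) [Field F] : Line F :=
  Projectivization.mk F ![1, 0] (by simp)

theorem smul_mk_eq_mk_iff (w : SL(2, F)) {u v : Fin 2 → F} (hu : u ≠ 0) (hv : v ≠ 0) :
    w • Projectivization.mk F u hu = Projectivization.mk F v hv ↔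
      (w 0 0 * u 0 + w 0 1 * u 1) * v 1 = (w 1 0 * u 0 + w 1 1 * u 1) * v 0 := by
  have hw : w • u ≠ 0 := (smul_ne_zero_iff_ne w).mpr hu
  have e0 : (w • u) 0 = w 0 0 * u 0 + w 0 1 * u 1 := by
    simp [Matrix.SpecialLinearGroup.smul_def]
  have e1 : (w • u) 1 = w 1 0 * u 0 + w 1 1 * u 1 := by
    simp [Matrix.SpecialLinearGroup.smul_def]
  rw [Projectivization.smul_mk, ← e0, ← e1, Projectivization.mk_eq_mk_iff']
  generalize w • u = y at hw
  constructor
  · rintro ⟨a, rfl⟩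
    simp only [Pi.smul_apply, smul_eq_mul]
    ring
  · intro h
    by_cases h0 : v 0 = 0
    · have h1 : v 1 ≠ 0 := fun h1 => hv (by ext i; fin_cases i <;> simp [h0, h1])
      refine ⟨y 1 / v 1, ?_⟩
      rw [h0, mul_zero] at h
      have := (mul_eq_zero.1 h).resolve_right h1
      ext i
      fin_cases i <;> simp [h0, this, h1]
    · refine ⟨y 0 / v 0, ?_⟩
      ext i
      fin_cases i
      · simp [h0]
      · simp only [Fin.mk_one, Fin.isValue, Pi.smul_apply, smul_eq_mul]
        field_simp
        rw [h, mul_comm]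

theorem smul_lineInfty_eq_self_iff (w : SL(2, F)) :
    w • lineInfty F = lineInfty F ↔ w 1 0 = 0 := by
  rw [lineInfty, smul_mk_eq_mk_iff]
  simp [eq_comm]

theorem exists_smul_lineInfty (A : Line F) : ∃ h : SL(2, F), h • lineInfty F = A :=
  MulAction.exists_smul_eq _ _ _

theorem exists_smul_pair {A A' B B' : Line F} (hA : A ≠ A') (hB : B ≠ B') :
    ∃ x : SL(2, F), x • A = B ∧ x • A' = B' :=
  (MulAction.is_two_pretransitive_iff.1 inferInstance) hA hB

end Line

section CharTwo

variable {F : Type*} [Field F] [CharP F 2]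

theorem exists_fixed_of_trace_eq_zero {t : SL(2, F)} (ht : tr t = 0) :
    ∃ A : Line F, t • A = A := by
  have h2 : (2 : F) = 0 := CharTwo.two_eq_zero
  have ht' := entry_eq_of_trace_eq_zero ht
  have dt := det_entries t
  rw [ht'] at dt
  by_cases hb : t 0 1 = 0
  · refine ⟨Projectivization.mk F ![0, 1] (by simp), ?_⟩
    rw [smul_mk_eq_mk_iff]
    simp [hb]
  -- This vector spans the kernel of `t - 1`.
  · refine ⟨Projectivization.mk F ![t 0 1, t 0 0 + 1] (by simp [hb]), ?_⟩
    rw [smul_mk_eq_mk_iff]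
    simp only [ht', Fin.isValue, cons_val_zero, cons_val_one]
    linear_combination t 0 1 * dt + (t 0 1 + t 0 0 * t 0 1) * h2

/-- The stabilizer of the fixed point of an involution, in terms of traces. -/
theorem smul_eq_self_iff_trace {t : SL(2, F)} (ht : tr t = 0) (ht1 : t ≠ 1) {A : Line F}
    (hA : t • A = A) (w : SL(2, F)) : w • A = A ↔ tr w = tr (w * t⁻¹) := by
  -- After moving `A` to infinity, `t` is upper unitriangular, and `tr (w t) - tr w` is `w 1 0 * t 0
  -- 1` with `t 0 1 ≠ 0`.
  obtain ⟨h, rfl⟩ := exists_smul_lineInfty A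
  have hs : ∀ x : SL(2, F), x • h • lineInfty F = h • lineInfty F ↔ (h⁻¹ * x * h) 1 0 = 0 := by
    intro x
    rw [← smul_lineInfty_eq_self_iff, mul_smul, mul_smul, inv_smul_eq_iff]
  rw [hs] at hA ⊢
  rw [← trace_conj h w, ← trace_conj h (w * t⁻¹)]
  rw [inv_eq_self_of_trace_eq_zero ht]
  have e : h⁻¹ * (w * t) * h = (h⁻¹ * w * h) * (h⁻¹ * t * h) := by group
  rw [e]
  rw [← trace_conj h] at ht
  have ht1' : h⁻¹ * t * h ≠ 1 := fun h1 => ht1 (by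
    rw [mul_assoc, inv_mul_eq_one] at h1
    exact mul_eq_right.1 h1.symm)
  generalize h⁻¹ * t * h = t at *
  generalize h⁻¹ * w * h = w at *
  have ht' := entry_eq_of_trace_eq_zero ht
  have dt := det_entries t
  rw [ht', hA] at dt
  have ha : t 0 0 = 1 := by
    refine CharTwo.sq_injective ?_
    simp only
    linear_combination dt
  have hb : t 0 1 ≠ 0 := by
    intro hb
    apply ht1'
    ext i j
    fin_cases i <;> fin_cases j <;> simp [ha, hb, hA, ht']
  rw [tr_def, tr_def, coe_mul, mul_apply, mul_apply, Fin.sum_univ_two,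
    Fin.sum_univ_two, hA, ht', ha]
  constructor
  · intro h
    rw [h]
    ring
  · intro h
    have : w 1 0 * t 0 1 = 0 := by linear_combination -h
    exact (mul_eq_zero.1 this).resolve_right hb

theorem exists_common_of_perp {x y : SL(2, F)} (h : Perp x y) :
    ∃ A : Line F, x • A = y • A := by
  unfold Perp at h
  rw [trace_mul_comm] at h
  obtain ⟨A, hA⟩ := exists_fixed_of_trace_eq_zero h
  exact ⟨A, by rwa [mul_smul, inv_smul_eq_iff] at hA⟩

theorem smul_eq_iff_trace {x y : SL(2, F)} (hxy : x ≠ y) (h : Perp x y) {A : Line F}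
    (hA : x • A = y • A) (w : SL(2, F)) :
    w • A = x • A ↔ tr (w * y⁻¹) = tr (w * x⁻¹) := by
  have ht : tr (y⁻¹ * x) = 0 := by rwa [trace_mul_comm]
  have := smul_eq_self_iff_trace ht (fun h => hxy (inv_mul_eq_one.1 h).symm)
    (A := A) (by rw [mul_smul, inv_smul_eq_iff, hA]) (y⁻¹ * w)
  rw [mul_smul, inv_smul_eq_iff, ← hA, trace_mul_comm y⁻¹ w] at this
  rw [this, _root_.mul_inv_rev, inv_inv, ← mul_assoc, trace_mul_comm _ y]
  simp only [← mul_assoc, mul_inv_cancel, one_mul]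

/-- Membership in the class of a line, in terms of orthogonality. -/
theorem trace_eq_iff_perp {x y : SL(2, F)} (hxy : x ≠ y) (h : Perp x y) (w : SL(2, F)) :
    tr (w * y⁻¹) = tr (w * x⁻¹) ↔
      (∀ t, Perp t x → Perp t y → Perp w t) ∨ (∀ t, Perp t x → Perp t y → ¬ Perp w t) := by
  have h2 : (2 : F) = 0 := CharTwo.two_eq_zero
  -- Right translation preserves orthogonality and the traces of quotients. The predicate `P` in
  -- `key` below stands for the identity or negation, so both alternatives are transported at once.
  wlog hy : y = 1 generalizing x y w
  · have := this (x := x * y⁻¹) (y := 1) (fun h => hxy (mul_inv_eq_one.1 h))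
      (by rw [← mul_inv_cancel y, perp_mul_right]; exact h) (w * y⁻¹) rfl
    rw [show w * y⁻¹ * 1⁻¹ = w * y⁻¹ by group,
      show w * y⁻¹ * (x * y⁻¹)⁻¹ = w * x⁻¹ by group] at this
    refine this.trans ?_
    have key : ∀ P : Prop → Prop, (∀ t, Perp t (x * y⁻¹) → Perp t 1 → P (Perp (w * y⁻¹) t)) ↔
        (∀ t, Perp t x → Perp t y → P (Perp w t)) := by
      intro P
      constructor
      · intro H t h1 h2
        rw [← perp_mul_right w t y⁻¹]
        refine H _ ((perp_mul_right _ _ _).2 h1) ?_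
        rw [← mul_inv_cancel y]
        exact (perp_mul_right _ _ _).2 h2
      · intro H t h1 h2
        rw [← perp_mul_right _ t y, inv_mul_cancel_right]
        refine H _ ?_ ?_
        · rw [← perp_mul_right _ _ y, inv_mul_cancel_right] at h1
          exact h1
        · rw [← perp_mul_right _ _ y, one_mul] at h2
          exact h2
    exact or_congr (key id) (key Not)
  subst hy
  have hx : tr x = 0 := by simpa [Perp] using h
  -- Elements of the line are their own inverses, so `tr (w t⁻¹)` is an affine function of the
  -- parameter `s`. If it is constant, it vanishes everywhere or nowhere; otherwise it has a zero
  -- but is not identically zero.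
  have key : ∀ (t : SL(2, F)) (s : F), tr t = 0 →
      t.1 = s • x.1 + (1 + s) • (1 : Matrix (Fin 2) (Fin 2) F) →
      tr (w * t⁻¹) = s * tr (w * x⁻¹) + (1 + s) * tr w := by
    intro t s ht hts
    rw [inv_eq_self_of_trace_eq_zero ht, inv_eq_self_of_trace_eq_zero hx, tr, tr, tr, coe_mul, hts,
      mul_add, trace_add, Matrix.mul_smul, Matrix.mul_smul, trace_smul, trace_smul, mul_one,
      coe_mul, smul_eq_mul, smul_eq_mul]
  rw [inv_one, mul_one]
  constructor
  · intro he
    have hc : ∀ t, Perp t x → Perp t 1 → tr (w * t⁻¹) = tr w := by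
      intro t h1 h3
      have ht : tr t = 0 := by simpa [Perp] using h3
      obtain ⟨s, hs⟩ := exists_coeff_of_trace_eq_zero hx hxy ht h1
      rw [key t s ht hs, ← he]
      linear_combination s * tr w * h2
    by_cases hw : tr w = 0
    · exact Or.inl fun t h1 h3 => (hc t h1 h3).trans hw
    · exact Or.inr fun t h1 h3 h4 => hw ((hc t h1 h3).symm.trans h4)
  · rintro (H | H)
    · have h1 := H 1 h.symm (perp_self _)
      have h3 := H x (perp_self _) h
      unfold Perp at h1 h3
      rw [h3]
      simpa using h1
    · by_contra hne
      have hd : tr w - tr (w * x⁻¹) ≠ 0 := sub_ne_zero.2 hne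
      -- The zero of the nonconstant affine function, giving a point of the line orthogonal to `w`.
      set s : F := tr w / (tr w - tr (w * x⁻¹)) with hs
      have hx' := entry_eq_of_trace_eq_zero hx
      have dx := det_entries x
      rw [hx'] at dx
      let t : SL(2, F) := ⟨s • x.1 + (1 + s) • (1 : Matrix (Fin 2) (Fin 2) F), by
        rw [det_fin_two]
        simp [hx']
        linear_combination s ^ 2 * dx + (s * x 0 0 * (1 + s) + s + s ^ 2) * h2⟩
      have ht : tr t = 0 := by
        rw [tr_def]
        simp [t, hx']
        linear_combination (s * x 0 0 + 1 + s) * h2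
      have htx : Perp t x := by
        unfold Perp
        rw [inv_eq_self_of_trace_eq_zero hx, tr, coe_mul]
        simp only [t]
        rw [add_mul, trace_add, Matrix.smul_mul, Matrix.smul_mul, trace_smul, trace_smul, one_mul,
          ← tr, hx, ← coe_mul, ← sq, (trace_eq_zero_iff_sq x).1 hx]
        simp [CharTwo.two_eq_zero]
      refine H t htx (by simpa [Perp] using ht) ?_
      unfold Perp
      rw [key t s ht rfl, hs]
      field_simp
      linear_combination (tr w ^ 2) * h2

end CharTwo

end AffineSL2

/-! ### Permutations preserving orthogonality -/

namespace AffineSL2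

open Matrix Matrix.SpecialLinearGroup
open scoped LinearAlgebra.Projectivization

section Line

variable {F : Type*} [Field F]

theorem exists_third_point (A B : Line F) : ∃ D : Line F, D ≠ A ∧ D ≠ B := by
  have h01 : Projectivization.mk (V := Fin 2 → F) F ![(1 : F), 0] (by simp) ≠
      Projectivization.mk (V := Fin 2 → F) F ![(0 : F), 1] (by simp) := by
    rw [Ne, ← one_smul SL(2, F) (Projectivization.mk (V := Fin 2 → F) F ![(1 : F), 0] _), smul_mk_eq_mk_iff]
    simp
  have h02 : Projectivization.mk (V := Fin 2 → F) F ![(1 : F), 0] (by simp) ≠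
      Projectivization.mk (V := Fin 2 → F) F ![(1 : F), 1] (by simp) := by
    rw [Ne, ← one_smul SL(2, F) (Projectivization.mk (V := Fin 2 → F) F ![(1 : F), 0] _), smul_mk_eq_mk_iff]
    simp
  have h12 : Projectivization.mk (V := Fin 2 → F) F ![(0 : F), 1] (by simp) ≠
      Projectivization.mk (V := Fin 2 → F) F ![(1 : F), 1] (by simp) := by
    rw [Ne, ← one_smul SL(2, F) (Projectivization.mk (V := Fin 2 → F) F ![(0 : F), 1] _), smul_mk_eq_mk_iff]
    simp
  generalize Projectivization.mk (V := Fin 2 → F) F ![(1 : F), 0] _ = P at *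
  generalize Projectivization.mk (V := Fin 2 → F) F ![(0 : F), 1] _ = Q at *
  generalize Projectivization.mk (V := Fin 2 → F) F ![(1 : F), 1] _ = R at *
  by_contra! H
  have := H P
  have := H Q
  have := H R
  rcases eq_or_ne P A <;> rcases eq_or_ne Q A <;> rcases eq_or_ne R A <;> grind

/-- By 2-transitivity this decides which classes meet. It is the relation on the grid of classes
that `exists_line_map` exploits. -/
theorem exists_smul_and_iff (A B A' B' : Line F) :
    (∃ w : SL(2, F), w • A = B ∧ w • A' = B') ↔ (A = A' ↔ B = B') := by
  constructor
  · rintro ⟨w, rfl, rfl⟩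
    exact (smul_left_cancel_iff w).symm
  · intro h
    by_cases hA : A = A'
    · have hB := h.1 hA
      subst hA hB
      obtain ⟨w, hw⟩ := MulAction.exists_smul_eq SL(2, F) A B
      exact ⟨w, hw, hw⟩
    · exact exists_smul_pair hA (fun hB => hA (h.2 hB))

theorem exists_not_commute : ∃ x y : SL(2, F), x * y ≠ y * x := by
  let x : SL(2, F) := ⟨!![1, 1; 0, 1], by simp⟩
  let y : SL(2, F) := ⟨!![1, 0; 1, 1], by simp⟩
  refine ⟨x, y, fun h => ?_⟩
  have h2 : x.1 * y.1 = y.1 * x.1 := by rw [← coe_mul, h, coe_mul]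
  have h3 := congrFun₂ h2 1 1
  simp [x, y, mul_apply, Fin.sum_univ_two] at h3

end Line

section CharTwo

variable {F : Type*} [Field F] [CharP F 2]

/-- Three fixed points force a scalar matrix, and in characteristic 2 the only scalar of determinant
one is `1`. -/
theorem eq_one_of_forall_smul_eq {w : SL(2, F)} (hw : ∀ A : Line F, w • A = A) : w = 1 := by
  have h1 : w 1 0 = 0 := (smul_lineInfty_eq_self_iff w).1 (hw _)
  have h2 := hw (Projectivization.mk F ![0, 1] (by simp))
  have h3 := hw (Projectivization.mk F ![1, 1] (by simp))
  rw [smul_mk_eq_mk_iff] at h2 h3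
  simp only [h1, Fin.isValue, cons_val_zero, cons_val_one, mul_zero, mul_one, zero_add] at h2 h3
  have d := det_entries w
  rw [h2, add_zero] at h3
  rw [h2, ← h3] at d
  have h0 : w 0 0 = 1 := CharTwo.sq_injective (by simp only; linear_combination d)
  ext i j
  fin_cases i <;> fin_cases j <;> simp [h0, h1, h2, ← h3]

theorem eq_of_forall_smul_eq {v w : SL(2, F)} (h : ∀ A : Line F, v • A = w • A) : v = w := by
  rw [← inv_mul_eq_one]
  refine eq_one_of_forall_smul_eq fun A => ?_
  rw [mul_smul, inv_smul_eq_iff, h]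

/-- Every class `{w | w A = B}` contains a pair of distinct orthogonal elements. -/
theorem exists_perp_pair (A B : Line F) :
    ∃ x y : SL(2, F), x ≠ y ∧ Perp x y ∧ x • A = B ∧ y • A = B := by
  obtain ⟨h, rfl⟩ := exists_smul_lineInfty A
  obtain ⟨k, rfl⟩ := exists_smul_lineInfty B
  let t : SL(2, F) := ⟨!![1, 1; 0, 1], by simp⟩
  have ht : t • lineInfty F = lineInfty F := by
    rw [smul_lineInfty_eq_self_iff]
    simp [t]
  have ht0 : tr t = 0 := by
    rw [tr_def]
    exact CharTwo.add_self_eq_zero _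
  have ht1 : t ≠ 1 := by
    intro h1
    have : t 0 1 = (1 : SL(2, F)) 0 1 := by rw [h1]
    simp [t] at this
  refine ⟨k * t * h⁻¹, k * h⁻¹, ?_, ?_, ?_, ?_⟩
  · simpa using ht1
  · rw [perp_mul_right]
    unfold Perp
    rw [trace_mul_comm, inv_mul_cancel_left]
    exact ht0
  · rw [mul_smul, mul_smul, inv_smul_smul, ht]
  · rw [mul_smul, inv_smul_smul]

/-- A permutation that preserves orthogonality permutes the classes `{w | w A = B}`. -/
theorem exists_class_image (ψ : Equiv.Perm SL(2, F)) (hψ : ∀ x y, Perp (ψ x) (ψ y) ↔ Perp x y)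
    (A B : Line F) : ∃ A' B' : Line F, ∀ w, ψ w • A' = B' ↔ w • A = B := by
  obtain ⟨x, y, hxy, hp, hx, hy⟩ := exists_perp_pair A B
  obtain ⟨A', hA'⟩ := exists_common_of_perp ((hψ x y).2 hp)
  refine ⟨A', ψ x • A', fun w => ?_⟩
  -- On both sides membership is now expressed through orthogonality to the line of a pair, which
  -- `ψ` preserves.
  rw [smul_eq_iff_trace (ψ.injective.ne hxy) ((hψ x y).2 hp) hA',
    trace_eq_iff_perp (ψ.injective.ne hxy) ((hψ x y).2 hp)]
  conv_rhs => rw [← hx]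
  rw [smul_eq_iff_trace hxy hp (hx.trans hy.symm), trace_eq_iff_perp hxy hp]
  have key : ∀ P : Prop → Prop, (∀ t, Perp t (ψ x) → Perp t (ψ y) → P (Perp (ψ w) t)) ↔
      (∀ t, Perp t x → Perp t y → P (Perp w t)) := by
    intro P
    constructor
    · intro H t h1 h2
      rw [← hψ]
      exact H _ ((hψ _ _).2 h1) ((hψ _ _).2 h2)
    · intro H t
      obtain ⟨t, rfl⟩ := ψ.surjective t
      rw [hψ, hψ, hψ]
      exact H t
  exact or_congr (key id) (key Not)

/-- A permutation that preserves orthogonality and fixes `1` is induced by an injection of the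
projective line, up to inversion. -/
theorem exists_line_map (ψ : Equiv.Perm SL(2, F)) (hψ : ∀ x y, Perp (ψ x) (ψ y) ↔ Perp x y)
    (h1 : ψ 1 = 1) : ∃ α : Line F → Line F, Function.Injective α ∧
      ((∀ w A, ψ w • α A = α (w • A)) ∨ (∀ w A, (ψ w)⁻¹ • α A = α (w • A))) := by
  choose a b hab using exists_class_image ψ hψ
  have hadj : ∀ A B A' B', (a A B = a A' B' ↔ b A B = b A' B') ↔ (A = A' ↔ B = B') := by
    intro A B A' B'
    rw [← exists_smul_and_iff, ← exists_smul_and_iff, ← ψ.exists_congr_right]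
    simp only [hab]
  -- The diagonal classes are those containing `1`, which is fixed.
  have hdiag : ∀ A, b A A = a A A := by
    intro A
    have := (hab A A 1).2 (one_smul _ _)
    rw [h1, one_smul] at this
    exact this.symm
  have hinj : ∀ A B, a A A = a B B → A = B := by
    intro A B hAB
    by_contra hne
    obtain ⟨D, hDA, hDB⟩ := exists_third_point A B
    obtain ⟨w, hw1, hw2⟩ := exists_smul_pair (B := A) (B' := D) hne hDA.symm
    have h3 := (hab A A w).2 hw1
    rw [hdiag, hAB] at h3
    nth_rw 2 [← hdiag] at h3
    have h4 := (hab B B w).1 h3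
    exact hDB (hw2.symm.trans h4)
  -- The class `(A, B)` is disjoint from `(A, A)` and from `(B, B)`, so its image shares exactly one
  -- coordinate with each of their images: the coordinates are kept or interchanged.
  have hor : ∀ A B, A ≠ B → (a A B = a A A ∧ b A B = a B B) ∨ (a A B = a B B ∧ b A B = a A A) := by
    intro A B hne
    have h3 := hadj A B A A
    have h4 := hadj A B B B
    have h5 := hinj A B
    rw [hdiag] at h3 h4
    grind
  -- Distinct classes in one row are disjoint, whereas the images of a kept and an interchanged one
  -- would meet. The same argument applies to columns, and moving along rows and columns makes the
  -- alternative uniform on the whole grid.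
  have hrow : ∀ A B D, A ≠ B → A ≠ D → B ≠ D → a A B = a A A → a A D = a A A := by
    intro A B D h3 h4 h5 h6
    have h7 := hadj A B A D
    have := hor A B h3
    have := hor A D h4
    have := hinj A B
    have := hinj A D
    have := hinj B D
    grind
  have hcol : ∀ A B D, A ≠ B → A ≠ D → B ≠ D → a A B = a A A → a D B = a D D := by
    intro A B D h3 h4 h5 h6
    have h7 := hadj A B D B
    have := hor A B h3
    have := hor D B h5.symm
    have := hinj A B
    have := hinj A D
    have := hinj B D
    grind
  have hswap : ∀ A B, A ≠ B → a A B = a A A → a B A = a B B := by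
    intro A B h3 h4
    obtain ⟨D, hDA, hDB⟩ := exists_third_point A B
    have h5 := hrow A B D h3 hDA.symm hDB.symm h4
    have h6 := hcol A D B hDA.symm h3 hDB h5
    exact hrow B D A hDB.symm h3.symm hDA h6
  have hall : ∀ A B, A ≠ B → a A B = a A A → ∀ C D, C ≠ D → a C D = a C C := by
    intro A B h3 h4 C D h5
    by_cases hCA : C = A
    · subst hCA
      by_cases hDB : D = B
      · rwa [hDB]
      · exact hrow C B D h3 h5 (Ne.symm hDB) h4
    · by_cases hDA : D = A
      · subst hDA
        by_cases hCB : C = B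
        · subst hCB
          exact hswap D C h3 h4
        · exact hcol B D C h3.symm (Ne.symm hCB) (Ne.symm hCA) (hswap D B h3 h4)
      · have h6 : a A D = a A A := by
          by_cases hDB : D = B
          · rwa [hDB]
          · exact hrow A B D h3 (Ne.symm hDA) (Ne.symm hDB) h4
        exact hcol A D C (Ne.symm hDA) (Ne.symm hCA) h5.symm h6
  refine ⟨fun A => a A A, fun A B => hinj A B, ?_⟩
  by_cases hex : ∃ A B, A ≠ B ∧ a A B = a A A
  · obtain ⟨A, B, h3, h4⟩ := hex
    left
    intro w C
    have h5 : a C (w • C) = a C C ∧ b C (w • C) = a (w • C) (w • C) := by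
      by_cases hC : C = w • C
      · rw [← hC]
        exact ⟨rfl, hdiag C⟩
      · have h6 := hall A B h3 h4 _ _ hC
        have := hor _ _ hC
        have := hinj C (w • C)
        grind
    have h7 := (hab C (w • C) w).2 rfl
    rwa [h5.1, h5.2] at h7
  · right
    push Not at hex
    intro w C
    rw [inv_smul_eq_iff]
    have h5 : a C (w • C) = a (w • C) (w • C) ∧ b C (w • C) = a C C := by
      by_cases hC : C = w • C
      · rw [← hC]
        exact ⟨rfl, hdiag C⟩
      · exact (hor _ _ hC).resolve_left fun h => hex _ _ hC h.1
    have h7 := (hab C (w • C) w).2 rfl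
    rw [h5.1, h5.2] at h7
    exact h7.symm

variable [Finite F]

/-- A permutation that preserves orthogonality and fixes `1` is an automorphism or an
antiautomorphism. -/
theorem map_mul_or_map_mul_rev (ψ : Equiv.Perm SL(2, F))
    (hψ : ∀ x y, Perp (ψ x) (ψ y) ↔ Perp x y) (h1 : ψ 1 = 1) :
    (∀ x y, ψ (x * y) = ψ x * ψ y) ∨ (∀ x y, ψ (x * y) = ψ y * ψ x) := by
  obtain ⟨α, hα, H⟩ := exists_line_map ψ hψ h1
  have hs : Function.Surjective α := Finite.surjective_of_injective hα
  rcases H with H | H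
  · left
    intro x y
    refine eq_of_forall_smul_eq fun A => ?_
    obtain ⟨A, rfl⟩ := hs A
    rw [H, mul_smul, mul_smul, H, H]
  · right
    intro x y
    rw [← _root_.inv_inj, _root_.mul_inv_rev]
    refine eq_of_forall_smul_eq fun A => ?_
    obtain ⟨A, rfl⟩ := hs A
    rw [H, mul_smul, mul_smul, H, H]

/-- An automorphism that preserves orthogonality is induced by a bijection of the projective
line. -/
theorem exists_line_map_of_map_mul (ψ : Equiv.Perm SL(2, F))
    (hψ : ∀ x y, Perp (ψ x) (ψ y) ↔ Perp x y) (hm : ∀ x y, ψ (x * y) = ψ x * ψ y) :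
    ∃ α : Line F → Line F, Function.Surjective α ∧ ∀ w A, ψ w • α A = α (w • A) := by
  have h1 : ψ 1 = 1 := by simpa using hm 1 1
  obtain ⟨α, hα, H⟩ := exists_line_map ψ hψ h1
  have hs : Function.Surjective α := Finite.surjective_of_injective hα
  refine ⟨α, hs, H.resolve_right fun H => ?_⟩
  -- With the inverse alternative, `ψ` would also reverse products, and the group would be
  -- commutative.
  obtain ⟨x, y, hxy⟩ := exists_not_commute (F := F)
  refine hxy (ψ.injective ?_)
  rw [hm y x, ← _root_.inv_inj, _root_.mul_inv_rev]
  refine eq_of_forall_smul_eq fun A => ?_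
  obtain ⟨A, rfl⟩ := hs A
  rw [H, mul_smul, mul_smul, H, H]

/-- An automorphism that preserves orthogonality and centralizes a subgroup that is transitive on
the projective line is the inner automorphism by an element commuting with that subgroup. -/
theorem exists_conj_of_centralizes (ψ : Equiv.Perm SL(2, F))
    (hψ : ∀ x y, Perp (ψ x) (ψ y) ↔ Perp x y) (hm : ∀ x y, ψ (x * y) = ψ x * ψ y)
    (c : SL(2, F)) (hc : ∀ A B : Line F, ∃ k : ℕ, c ^ k • A = B) (hψc : ψ c = c) :
    ∃ k : ℕ, ∀ x, ψ x = c ^ k * x * (c ^ k)⁻¹ := by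
  obtain ⟨α, hs, H⟩ := exists_line_map_of_map_mul ψ hψ hm
  obtain ⟨k, hk⟩ := hc (lineInfty F) (α (lineInfty F))
  have hpow : ∀ n : ℕ, ∀ A, c ^ n • α A = α (c ^ n • A) := by
    intro n A
    have h1 : ψ (c ^ n) = c ^ n := by
      induction n with
      | zero => simpa using hm 1 1
      | succ n ih => rw [pow_succ, hm, ih, hψc]
    rw [← H, h1]
  -- `α` commutes with the powers of `c`, so by transitivity it is determined by its value at one
  -- point.
  have hα : ∀ A, α A = c ^ k • A := by
    intro A
    obtain ⟨n, rfl⟩ := hc (lineInfty F) A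
    rw [← hpow, ← hk, smul_smul, smul_smul, ← pow_add, ← pow_add, add_comm]
  refine ⟨k, fun x => eq_of_forall_smul_eq fun A => ?_⟩
  obtain ⟨A, rfl⟩ := hs A
  rw [H, hα, hα, mul_smul, mul_smul, inv_smul_smul]

end CharTwo

end AffineSL2

/-! ### A computable model of the field and of its matrices -/

namespace AffineSL2

open Matrix Matrix.SpecialLinearGroup

/-- The polynomials `b0 + b1 X + b2 X ^ 2` over the field with two elements, multiplied modulo
`X ^ 3 + X + 1`. -/
structure K8 where
  /-- the constant coefficient -/
  b0 : Bool
  /-- the linear coefficient -/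
  b1 : Bool
  /-- the quadratic coefficient -/
  b2 : Bool
deriving DecidableEq

namespace K8

instance : Zero K8 := ⟨⟨false, false, false⟩⟩

instance : Add K8 := ⟨fun x y => ⟨x.b0 ^^ y.b0, x.b1 ^^ y.b1, x.b2 ^^ y.b2⟩⟩

/-- Multiplication by the class of `X`. -/
def mulX (x : K8) : K8 := ⟨x.b2, x.b0 ^^ x.b2, x.b1⟩

instance : Mul K8 :=
  ⟨fun x y => bif x.b0 then
      (bif x.b1 then (bif x.b2 then y + (y.mulX + y.mulX.mulX) else y + y.mulX)
        else (bif x.b2 then y + y.mulX.mulX else y))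
    else
      (bif x.b1 then (bif x.b2 then y.mulX + y.mulX.mulX else y.mulX)
        else (bif x.b2 then y.mulX.mulX else 0))⟩

theorem mul_def (x y : K8) : x * y = bif x.b0 then
      (bif x.b1 then (bif x.b2 then y + (y.mulX + y.mulX.mulX) else y + y.mulX)
        else (bif x.b2 then y + y.mulX.mulX else y))
    else
      (bif x.b1 then (bif x.b2 then y.mulX + y.mulX.mulX else y.mulX)
        else (bif x.b2 then y.mulX.mulX else 0)) := rfl

/-- The powers of the class of `X`. -/
def X : ℕ → K8
  | 0 => ⟨true, false, false⟩
  | n + 1 => mulX (X n)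

/-- The position of an element in the lexicographic order. -/
def index (x : K8) : ℕ := 4 * x.b2.toNat + 2 * x.b1.toNat + x.b0.toNat

theorem index_lt (x : K8) : x.index < 8 := by
  rcases x with ⟨a, b, c⟩
  revert a b c
  decide

theorem index_injective : Function.Injective index := by
  rintro ⟨a, b, c⟩ ⟨a', b', c'⟩
  revert a b c a' b' c'
  decide

/-- All elements. -/
def all : List K8 :=
  [⟨false, false, false⟩, ⟨false, false, true⟩, ⟨false, true, false⟩, ⟨false, true, true⟩,
    ⟨true, false, false⟩, ⟨true, false, true⟩, ⟨true, true, false⟩, ⟨true, true, true⟩]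

theorem mem_all (x : K8) : x ∈ all := by
  rcases x with ⟨a, b, c⟩
  revert a b c
  decide

theorem exists_mul_eq_one : ∀ x ∈ all, x ≠ 0 → ∃ y ∈ all, x * y = X 0 := by
  decide +kernel

section Val

variable {F : Type*} [Field F]

/-- The value of a bit. -/
def bit (F : Type*) [Field F] (b : Bool) : F := bif b then 1 else 0

/-- Evaluation at `z`. -/
def val (z : F) (x : K8) : F := bit F x.b0 + bit F x.b1 * z + bit F x.b2 * z ^ 2

theorem val_zero (z : F) : val z 0 = 0 := by
  change bit F false + bit F false * z + bit F false * z ^ 2 = 0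
  simp [bit]

variable [CharP F 2]

theorem bit_xor (a b : Bool) : bit F (a ^^ b) = bit F a + bit F b := by
  cases a <;> cases b <;> simp [bit, CharTwo.add_self_eq_zero]

theorem val_add (z : F) (x y : K8) : val z (x + y) = val z x + val z y := by
  change bit F (x.b0 ^^ y.b0) + bit F (x.b1 ^^ y.b1) * z + bit F (x.b2 ^^ y.b2) * z ^ 2 = _
  rw [bit_xor, bit_xor, bit_xor, val, val]
  ring

variable {z : F} (hz : z ^ 3 = z + 1)
include hz

theorem val_mulX (x : K8) : val z x.mulX = z * val z x := by
  simp only [val, mulX, bit_xor]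
  linear_combination - bit F x.b2 * hz

theorem val_X (n : ℕ) : val z (X n) = z ^ n := by
  induction n with
  | zero => simp [X, val, bit]
  | succ n ih => rw [X, val_mulX hz, ih, pow_succ']

theorem val_mul (x y : K8) : val z (x * y) = val z x * val z y := by
  rcases x with ⟨a, b, c⟩
  have e : val z ⟨a, b, c⟩ = bit F a + bit F b * z + bit F c * z ^ 2 := rfl
  rw [e, mul_def]
  cases a <;> cases b <;> cases c <;>
    simp only [cond_true, cond_false, val_add, val_mulX hz, val_zero, bit] <;>
    ring

/-- Nonzero elements of the model are invertible, so multiplicativity keeps their values from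
vanishing. -/
theorem val_injective : Function.Injective (val z) := by
  intro x y hxy
  have h1 : val z (x + y) = 0 := by
    rw [val_add, hxy]
    exact CharTwo.add_self_eq_zero _
  have h2 : x + y = 0 := by
    by_contra h
    obtain ⟨w, -, hw⟩ := exists_mul_eq_one (x + y) (mem_all _) h
    have h3 := val_mul hz (x + y) w
    rw [hw, h1, val_X hz, pow_zero, zero_mul] at h3
    exact one_ne_zero h3
  revert h2
  rcases x with ⟨a, b, c⟩
  rcases y with ⟨a', b', c'⟩
  clear h1 hxy
  revert a b c a' b' c'
  decide

theorem val_bijective (hF : Nat.card F = 8) : Function.Bijective (val z) := by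
  have : Finite F := Nat.finite_of_card_ne_zero (by rw [hF]; decide)
  have e : K8 ≃ Bool × Bool × Bool :=
    ⟨fun x => (x.b0, x.b1, x.b2), fun w => ⟨w.1, w.2.1, w.2.2⟩, fun _ => rfl, fun _ => rfl⟩
  have : Finite K8 := Finite.of_equiv _ e.symm
  refine (val_injective hz).bijective_of_nat_card_le ?_
  rw [hF, Nat.card_congr e]
  simp

end Val

end K8

/-- The two by two matrices with entries in `K8`. -/
structure M8 where
  /-- the upper left entry -/
  a : K8
  /-- the upper right entry -/
  b : K8
  /-- the lower left entry -/
  c : K8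
  /-- the lower right entry -/
  d : K8
deriving DecidableEq

namespace M8

open K8

instance : One M8 := ⟨⟨X 0, 0, 0, X 0⟩⟩

instance : Mul M8 := ⟨fun x y => ⟨x.a * y.a + x.b * y.c, x.a * y.b + x.b * y.d,
  x.c * y.a + x.d * y.c, x.c * y.b + x.d * y.d⟩⟩

/-- The adjugate. -/
def adj (x : M8) : M8 := ⟨x.d, x.b, x.c, x.a⟩

/-- The determinant. -/
def det (x : M8) : K8 := x.a * x.d + x.b * x.c

/-- Squaring of the entries. -/
def frob (x : M8) : M8 := ⟨x.a * x.a, x.b * x.b, x.c * x.c, x.d * x.d⟩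

/-- The position of a matrix in a fixed enumeration. -/
def index (x : M8) : ℕ := 512 * x.a.index + 64 * x.b.index + 8 * x.c.index + x.d.index

theorem index_injective : Function.Injective index := by
  intro x y h
  unfold index at h
  have := K8.index_lt x.a
  have := K8.index_lt x.b
  have := K8.index_lt x.c
  have := K8.index_lt x.d
  have := K8.index_lt y.a
  have := K8.index_lt y.b
  have := K8.index_lt y.c
  have := K8.index_lt y.d
  have h1 := K8.index_injective (a₁ := x.a) (a₂ := y.a) (by omega)
  have h2 := K8.index_injective (a₁ := x.b) (a₂ := y.b) (by omega)
  have h3 := K8.index_injective (a₁ := x.c) (a₂ := y.c) (by omega)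
  have h4 := K8.index_injective (a₁ := x.d) (a₂ := y.d) (by omega)
  cases x
  cases y
  simp_all

end M8

end AffineSL2

/-! ### Computation of the quotients in `C` and in the sets `D*` -/

namespace AffineSL2

namespace M8

open K8

/-- The quotients `x y⁻¹` of distinct entries of a list. -/
def starList (l : List M8) : List M8 :=
  ((l ×ˢ l).filter fun w => w.1 ≠ w.2).map fun w => w.1 * w.2.adj

/-- The conjugate by `h` of each entry of a list. -/
def conjList (h : M8) (l : List M8) : List M8 := l.map fun x => h.adj * x * h

/-- The entries of a list, multiplied by `h` from the right. -/
def mulList (l : List M8) (h : M8) : List M8 := l.map fun x => x * h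

/-- The matrix of `g`. -/
def g : M8 := ⟨X 2, X 4, X 4, X 1⟩

/-- The matrix of `f`. -/
def f : M8 := ⟨0, X 0, X 0, 0⟩

/-- The powers of `g`. -/
def gPow : ℕ → M8
  | 0 => 1
  | n + 1 => gPow n * g

/-- The list of the elements of `C`. -/
def listC : List M8 := (List.range 9).map gPow

/-- The list of the elements of `D₁`. -/
def listD₁ : List M8 :=
  [1, ⟨X 5, X 0, X 5, X 6⟩, ⟨X 4, X 2, X 0, X 2⟩, ⟨X 0, X 1, X 6, 0⟩, ⟨0, X 1, X 6, X 2⟩,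
    ⟨X 0, X 4, X 2, X 2⟩, ⟨X 3, X 5, X 3, X 0⟩, ⟨X 5, X 4, X 2, X 4⟩, ⟨X 2, 0, 0, X 5⟩]

/-- The list of the elements of `D₄`. -/
def listD₄ : List M8 :=
  [1, ⟨X 5, 0, X 6, X 2⟩, ⟨X 1, X 6, X 4, X 0⟩, ⟨X 5, X 2, X 5, 0⟩, ⟨X 3, X 4, X 6, X 5⟩,
    ⟨X 0, X 0, X 3, X 1⟩, ⟨X 0, X 1, X 0, X 3⟩, ⟨X 1, X 2, X 0, X 5⟩, ⟨X 1, 0, X 1, X 6⟩]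

/-- The list of the elements of `D₄'`. -/
def listD₄' : List M8 := conjList f listD₄

/-- A list and its conjugates by `g` and `g ^ 2`. -/
def orbit (l : List M8) : List (List M8) := [l, conjList g l, conjList (g * g) l]

/-- The lists of the arcuate blocks of the Osterunital. -/
def listsO : List (List M8) := orbit listD₁ ++ orbit listD₄

/-- The lists of the arcuate blocks of the Pfingstunital. -/
def listsP : List (List M8) := orbit listD₁ ++ orbit listD₄'

/-- All nontrivial elements of `C` and of the sets `D*`, for `D` in a list of arcuate blocks. -/
def cover (L : List (List M8)) : List M8 := (listC.tail :: L.map starList).flatten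

/-- Test for pairwise distinctness of the entries of a list and the ones of a bit mask. -/
def fresh : ℕ → List ℕ → Bool
  | _, [] => true
  | m, n :: l => !m.testBit n && fresh (m ||| 1 <<< n) l

/-- A bit mask of the entries already seen replaces the quadratic number of pairwise comparisons by
a single pass. -/
theorem fresh_spec (m : ℕ) (l : List ℕ) (h : fresh m l = true) :
    l.Nodup ∧ ∀ n ∈ l, m.testBit n = false := by
  induction l generalizing m with
  | nil => simp
  | cons n l ih =>
    rw [fresh, Bool.and_eq_true, Bool.not_eq_true'] at h
    obtain ⟨h1, h2⟩ := ih _ h.2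
    simp only [Nat.testBit_or, Bool.or_eq_false_iff] at h2
    refine ⟨List.nodup_cons.2 ⟨fun hn => ?_, h1⟩, ?_⟩
    · simpa using (h2 n hn).2
    · intro k hk
      rcases List.mem_cons.1 hk with rfl | hk
      · exact h.1
      · exact (h2 k hk).1

/-- The bit mask of a list. -/
def mask : ℕ → List ℕ → ℕ
  | m, [] => m
  | m, n :: l => mask (m ||| 1 <<< n) l

theorem testBit_mask (m : ℕ) (l : List ℕ) (k : ℕ) (h : (mask m l).testBit k = true) :
    m.testBit k = true ∨ k ∈ l := by
  induction l generalizing m with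
  | nil => exact Or.inl h
  | cons n l ih =>
    rw [mask] at h
    rcases ih _ h with h | h
    · rw [Nat.testBit_or, Bool.or_eq_true] at h
      rcases h with h | h
      · exact Or.inl h
      · right
        rw [Nat.one_shiftLeft, Nat.testBit_two_pow, decide_eq_true_eq] at h
        exact List.mem_cons.2 (Or.inl h.symm)
    · exact Or.inr (List.mem_cons_of_mem _ h)

/-- Test that the bit mask `m` contains all matrices of determinant one with distinct diagonal
entries. -/
def covers (m : ℕ) : Bool :=
  all.all fun a => all.all fun d => a == d || all.all fun b => all.all fun c =>
    !(a * d + b * c == X 0) || m.testBit (index ⟨a, b, c, d⟩)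

-- Distinctness of all listed quotients contains condition (Q), within one `D*`, as well as the
-- disjointness in (P), between different parts.
set_option maxRecDepth 100000 in
theorem fresh_coverO : fresh 0 ((cover listsO).map index) = true := by
  decide +kernel

set_option maxRecDepth 100000 in
theorem fresh_coverP : fresh 0 ((cover listsP).map index) = true := by
  decide +kernel

set_option maxRecDepth 100000 in
theorem covers_coverO : covers (mask 0 ((cover listsO).map index)) = true := by
  decide +kernel

set_option maxRecDepth 100000 in
theorem covers_coverP : covers (mask 0 ((cover listsP).map index)) = true := by
  decide +kernel

end M8

end AffineSL2

/-! ### Sylow 2-subgroups, and the transfer to codes -/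

namespace AffineSL2

open Matrix Matrix.SpecialLinearGroup

section Sylow

variable {F : Type*} [Field F]

theorem ncard_sylow_ne [Finite F] (T : Sylow 2 SL(2, F)) : (T : Set SL(2, F)).ncard ≠ 9 := by
  obtain ⟨n, hn⟩ := T.isPGroup'.exists_card_eq
  rw [← Nat.card_coe_set_eq]
  change Nat.card T ≠ 9
  rw [hn]
  intro h
  rcases n with _ | n
  · simp at h
  · rw [pow_succ] at h
    omega

variable [CharP F 2]

/-- In characteristic 2, `x - 1` is nilpotent and thus has trace zero; moreover `tr 1 = 2 = 0`. -/
theorem trace_eq_zero_of_pow {x : SL(2, F)} {k : ℕ} (hx : x ^ 2 ^ k = 1) : tr x = 0 := by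
  have h1 : (x.1 - 1) ^ 2 ^ k = 0 := by
    rw [sub_pow_char_pow_of_commute (p := 2) (h := Commute.one_right _), ← coe_pow, hx]
    simp
  have h2 : IsNilpotent (x.1 - 1) := ⟨_, h1⟩
  have h3 := (Matrix.isNilpotent_trace_of_isNilpotent h2).eq_zero
  rw [trace_sub, ← tr, trace_one, Fintype.card_fin] at h3
  rwa [Nat.cast_ofNat, CharTwo.two_eq_zero, sub_zero] at h3

theorem trace_eq_zero_of_mem_sylow {T : Sylow 2 SL(2, F)} {x : SL(2, F)} (hx : x ∈ T) :
    tr x = 0 := by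
  obtain ⟨k, hk⟩ := T.isPGroup' ⟨x, hx⟩
  exact trace_eq_zero_of_pow (k := k) (congrArg Subtype.val hk)

theorem exists_sylow_of_trace_eq_zero {x : SL(2, F)} (hx : tr x = 0) :
    ∃ T : Sylow 2 SL(2, F), x ∈ T := by
  rw [trace_eq_zero_iff_sq] at hx
  have h : IsPGroup 2 (Subgroup.zpowers x) := by
    rintro ⟨_, n, rfl⟩
    refine ⟨1, Subtype.ext ?_⟩
    change (x ^ n) ^ 2 ^ 1 = 1
    rw [pow_one, ← zpow_natCast, zpow_comm, zpow_natCast, hx, _root_.one_zpow]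
  obtain ⟨T, hT⟩ := h.exists_le_sylow
  exact ⟨T, hT (Subgroup.mem_zpowers x)⟩

theorem perp_iff_exists_sylow (x y : SL(2, F)) :
    Perp x y ↔ ∃ T : Sylow 2 SL(2, F), x * y⁻¹ ∈ T :=
  ⟨fun h => exists_sylow_of_trace_eq_zero h, fun ⟨_, h⟩ => trace_eq_zero_of_mem_sylow h⟩

/-- If `tr x ≠ 0`, the off-diagonal entries of `x w = w x` make `w` diagonal, hence equal to `1`. So
centralizers of involutions are 2-groups. -/
theorem trace_eq_zero_of_commute {w x : SL(2, F)} (hw : tr w = 0) (hw1 : w ≠ 1)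
    (h : x * w = w * x) : tr x = 0 := by
  have hw' := entry_eq_of_trace_eq_zero hw
  have dw := det_entries w
  have h' : x.1 * w.1 = w.1 * x.1 := by rw [← coe_mul, h, coe_mul]
  have h01 := congrFun₂ h' 0 1
  have h10 := congrFun₂ h' 1 0
  rw [mul_apply, mul_apply, Fin.sum_univ_two, Fin.sum_univ_two, hw'] at h01 h10
  rw [hw'] at dw
  have e1 : w 0 1 * (x 0 0 - x 1 1) = 0 := by linear_combination h01
  have e2 : w 1 0 * (x 0 0 - x 1 1) = 0 := by linear_combination -h10
  rw [tr_def]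
  rw [← CharTwo.sub_eq_add]
  by_contra hne
  have hb := (mul_eq_zero.1 e1).resolve_right hne
  have hc := (mul_eq_zero.1 e2).resolve_right hne
  have ha : w 0 0 = 1 := CharTwo.sq_injective (by
    simp only
    rw [hb] at dw
    linear_combination dw)
  apply hw1
  ext i j
  fin_cases i <;> fin_cases j <;> simp [ha, hb, hc, hw']

/-- A Sylow 2-subgroup has exponent 2, so it is abelian and lies in the centralizer of `w`. This is
a 2-group, so maximality gives equality. -/
theorem sylow_eq_of_mem {T T' : Sylow 2 SL(2, F)} {w : SL(2, F)} (hw1 : w ≠ 1) (hT : w ∈ T)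
    (hT' : w ∈ T') : T = T' := by
  have hw := trace_eq_zero_of_mem_sylow hT
  have hZ : IsPGroup 2 (Subgroup.centralizer {w}) := by
    rintro ⟨x, hx⟩
    refine ⟨1, Subtype.ext ?_⟩
    rw [Subgroup.mem_centralizer_singleton_iff] at hx
    change x ^ 2 ^ 1 = 1
    rw [pow_one, ← trace_eq_zero_iff_sq]
    exact trace_eq_zero_of_commute hw hw1 hx
  have key : ∀ T : Sylow 2 SL(2, F), w ∈ T → (T : Subgroup SL(2, F)) = .centralizer {w} := by
    intro T hT
    refine (T.is_maximal' hZ fun x hx => ?_).symm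
    rw [Subgroup.mem_centralizer_singleton_iff]
    have hi : ∀ y ∈ T, y⁻¹ = y := fun y hy =>
      inv_eq_self_of_trace_eq_zero (trace_eq_zero_of_mem_sylow hy)
    rw [← hi _ (mul_mem hx hT), _root_.mul_inv_rev, hi _ hx, hi _ hT]
  exact Sylow.ext ((key T hT).trans (key T' hT').symm)

theorem exists_involution : ∃ t : SL(2, F), tr t = 0 ∧ t ≠ 1 := by
  let t : SL(2, F) := ⟨!![1, 1; 0, 1], by simp⟩
  refine ⟨t, ?_, fun h => ?_⟩
  · rw [tr_def]
    exact CharTwo.add_self_eq_zero _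
  · have : t 0 1 = (1 : SL(2, F)) 0 1 := by rw [h]
    simp [t] at this

variable [Finite F]

theorem exists_ne_one_mem_sylow (T : Sylow 2 SL(2, F)) : ∃ x ∈ T, x ≠ 1 := by
  obtain ⟨t, ht, ht1⟩ := exists_involution (F := F)
  have h2 : 2 ∣ Nat.card SL(2, F) := by
    have := orderOf_dvd_natCard t
    rwa [orderOf_eq_prime ((trace_eq_zero_iff_sq t).1 ht) ht1] at this
  obtain ⟨x, hx⟩ := (Subgroup.ne_bot_iff_exists_ne_one).1 (T.ne_bot_of_dvd_card h2)
  exact ⟨x, x.2, fun h => hx (Subtype.ext h)⟩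

end Sylow

section Code

variable {F : Type*} [Field F]

instance : Nonempty K8 := ⟨0⟩

/-- The coordinates of a matrix with respect to the powers of `z`. -/
noncomputable def code (z : F) (x : SL(2, F)) : M8 :=
  ⟨Function.invFun (K8.val z) (x 0 0), Function.invFun (K8.val z) (x 0 1),
    Function.invFun (K8.val z) (x 1 0), Function.invFun (K8.val z) (x 1 1)⟩

/-- The matrix with given coordinates. -/
def M8.val (z : F) (c : M8) : Matrix (Fin 2) (Fin 2) F :=
  !![c.a.val z, c.b.val z; c.c.val z, c.d.val z]

variable [CharP F 2] {z : F} (hz : z ^ 3 = z + 1) (hF : Nat.card F = 8)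
include hz hF

theorem invFun_val (x : F) : K8.val z (Function.invFun (K8.val z) x) = x :=
  Function.invFun_eq ((K8.val_bijective hz hF).2 x)

theorem code_eq_iff (x : SL(2, F)) (c : M8) : code z x = c ↔ x.1 = c.val z := by
  constructor
  · rintro rfl
    ext i j
    fin_cases i <;> fin_cases j <;> simp [M8.val, code, invFun_val hz hF]
  · intro h
    have e : ∀ i j, x i j = M8.val z c i j := fun i j => by rw [h]
    have hl := Function.leftInverse_invFun (K8.val_bijective hz hF).1
    cases c
    simp only [code, e, M8.val]
    simp [hl _]

theorem val_code (x : SL(2, F)) : (code z x).val z = x.1 :=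
  ((code_eq_iff hz hF x _).1 rfl).symm

theorem code_injective : Function.Injective (code z) := by
  intro x y h
  apply Subtype.ext
  rw [← val_code hz hF x, h, val_code hz hF]

theorem code_one : code z 1 = 1 := by
  rw [code_eq_iff hz hF]
  change _ = !![K8.val z (K8.X 0), K8.val z 0; K8.val z 0, K8.val z (K8.X 0)]
  simp [K8.val_X hz, K8.val_zero, one_fin_two]

theorem code_mul (x y : SL(2, F)) : code z (x * y) = code z x * code z y := by
  rw [code_eq_iff hz hF, coe_mul, ← val_code hz hF x, ← val_code hz hF y]
  generalize code z x = a
  generalize code z y = b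
  change _ = !![K8.val z (a.a * b.a + a.b * b.c), K8.val z (a.a * b.b + a.b * b.d);
    K8.val z (a.c * b.a + a.d * b.c), K8.val z (a.c * b.b + a.d * b.d)]
  simp only [K8.val_add, K8.val_mul hz, M8.val, mul_fin_two]

theorem code_inv (x : SL(2, F)) : code z x⁻¹ = (code z x).adj := by
  rw [code_eq_iff hz hF, coe_inv, ← val_code hz hF x, adjugate_fin_two]
  simp [M8.val, M8.adj, CharTwo.neg_eq]

theorem det_code (x : SL(2, F)) : (code z x).det = K8.X 0 := by
  have h := x.2
  rw [← val_code hz hF x, M8.val, det_fin_two_of, CharTwo.sub_eq_add, ← K8.val_mul hz,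
    ← K8.val_mul hz, ← K8.val_add, ← pow_zero z, ← K8.val_X hz 0] at h
  exact (K8.val_bijective hz hF).1 h

theorem exists_code_eq {c : M8} (hc : c.det = K8.X 0) : ∃ x : SL(2, F), code z x = c := by
  refine ⟨⟨c.val z, ?_⟩, (code_eq_iff hz hF _ _).2 rfl⟩
  rw [M8.val, det_fin_two_of, CharTwo.sub_eq_add, ← K8.val_mul hz, ← K8.val_mul hz, ← K8.val_add]
  change K8.val z c.det = 1
  rw [hc, K8.val_X hz, pow_zero]

theorem trace_eq_zero_iff_code (x : SL(2, F)) : tr x = 0 ↔ (code z x).a = (code z x).d := by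
  rw [← (K8.val_bijective hz hF).1.eq_iff, tr_def, ← CharTwo.sub_eq_add, sub_eq_zero]
  simp only [code, invFun_val hz hF]

end Code

end AffineSL2

/-! ### From lists of codes to affine unitals -/

namespace AffineSL2

open Matrix Matrix.SpecialLinearGroup

/-- The elements of `SL(2,F)` whose codes belong to a list. -/
def toSet {F : Type*} [Field F] (z : F) (l : List M8) : Set SL(2, F) := {x | code z x ∈ l}

namespace M8

theorem gPow_nine : gPow 9 = 1 := by decide +kernel

theorem gPow_three : gPow 3 ≠ 1 := by decide +kernel

theorem listsO_facts : ∀ l ∈ listsO, l.Nodup ∧ l.length = 9 ∧ 1 ∈ l ∧ ∀ x ∈ l, x.det = K8.X 0 := by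
  decide +kernel

theorem listsP_facts : ∀ l ∈ listsP, l.Nodup ∧ l.length = 9 ∧ 1 ∈ l ∧ ∀ x ∈ l, x.det = K8.X 0 := by
  decide +kernel

set_option maxRecDepth 100000 in
theorem coverO_diag : ∀ x ∈ cover listsO, x.a ≠ x.d := by
  decide +kernel

set_option maxRecDepth 100000 in
theorem coverP_diag : ∀ x ∈ cover listsP, x.a ≠ x.d := by
  decide +kernel

theorem nodup_of_fresh {l : List M8} (h : fresh 0 (l.map index) = true) : l.Nodup :=
  (fresh_spec _ _ h).1.of_map _

theorem mem_of_covers {l : List M8} (h : covers (mask 0 (l.map index)) = true) (x : M8)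
    (hx : x.det = K8.X 0) (hd : x.a ≠ x.d) : x ∈ l := by
  simp only [covers, List.all_eq_true, Bool.or_eq_true, beq_iff_eq, Bool.not_eq_true'] at h
  have h1 := (h x.a (K8.mem_all _) x.d (K8.mem_all _)).resolve_left hd x.b (K8.mem_all _) x.c
    (K8.mem_all _)
  have h2 := h1.resolve_left (by simpa [det] using hx)
  rcases testBit_mask _ _ _ h2 with h3 | h3
  · simp at h3
  · obtain ⟨y, hy, hxy⟩ := List.mem_map.1 h3
    rw [index_injective hxy] at hy
    exact hy

theorem mem_starList {l : List M8} {w : M8} :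
    w ∈ starList l ↔ ∃ x ∈ l, ∃ y ∈ l, x ≠ y ∧ w = x * y.adj := by
  simp only [starList, List.mem_map, List.mem_filter, List.mem_product, Prod.exists,
    decide_eq_true_eq]
  constructor
  · rintro ⟨x, y, ⟨⟨hx, hy⟩, hxy⟩, rfl⟩
    exact ⟨x, hx, y, hy, hxy, rfl⟩
  · rintro ⟨x, hx, y, hy, hxy, rfl⟩
    exact ⟨x, y, ⟨⟨hx, hy⟩, hxy⟩, rfl⟩

end M8

section

variable {F : Type*} [Field F] [CharP F 2] {z : F} (hz : z ^ 3 = z + 1) (hF : Nat.card F = 8)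
include hz hF

theorem code_g : code z (g z hz) = M8.g := by
  rw [code_eq_iff hz hF]
  simp [M8.val, M8.g, g, K8.val_X hz]

theorem code_f : code z (f F) = M8.f := by
  rw [code_eq_iff hz hF]
  simp [M8.val, M8.f, f, K8.val_X hz, K8.val_zero]

theorem code_g_pow (n : ℕ) : code z (g z hz ^ n) = M8.gPow n := by
  induction n with
  | zero => rw [pow_zero, code_one hz hF]; rfl
  | succ n ih => rw [pow_succ, code_mul hz hF, ih, code_g hz hF]; rfl

theorem g_pow_nine : g z hz ^ 9 = 1 := by
  apply code_injective hz hF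
  rw [code_g_pow hz hF, M8.gPow_nine, code_one hz hF]

theorem orderOf_g : orderOf (g z hz) = 9 := by
  have := orderOf_eq_prime_pow (p := 3) (n := 1) (x := g z hz)
    (fun h => M8.gPow_three (by rw [← code_g_pow hz hF, ← code_one hz hF, ← h]; rfl))
    (g_pow_nine hz hF)
  simpa using this

theorem mem_C_iff_pow (x : SL(2, F)) : x ∈ C z hz ↔ ∃ n < 9, g z hz ^ n = x := by
  classical
  rw [C, (isOfFinOrder_iff_pow_eq_one.2 ⟨9, by norm_num, g_pow_nine hz hF⟩).mem_zpowers_iff_mem_range_orderOf,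
    orderOf_g hz hF]
  simp

theorem coe_C : (C z hz : Set SL(2, F)) = toSet z M8.listC := by
  ext x
  simp only [SetLike.mem_coe, mem_C_iff_pow hz hF, toSet, Set.mem_ofPred_eq, M8.listC,
    List.mem_map, List.mem_range]
  refine exists_congr fun n => and_congr_right fun _ => ?_
  rw [← code_g_pow hz hF, (code_injective hz hF).eq_iff]

theorem card_C : Nat.card (C z hz) = 9 := by
  rw [C, Nat.card_zpowers, orderOf_g hz hF]

theorem mem_C_iff (x : SL(2, F)) : x ∈ C z hz ↔ code z x ∈ M8.listC := by
  rw [← SetLike.mem_coe, coe_C hz hF]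
  rfl

/-- Determinant one ensures that each entry of the list is the code of a group element. -/
theorem star_toSet {l : List M8} (hl : ∀ x ∈ l, x.det = K8.X 0) :
    star (toSet z l) = toSet z (M8.starList l) := by
  ext w
  simp only [star, toSet, Set.mem_ofPred_eq, M8.mem_starList]
  constructor
  · rintro ⟨x, hx, y, hy, hxy, rfl⟩
    exact ⟨_, hx, _, hy, (code_injective hz hF).ne hxy, by rw [code_mul hz hF, code_inv hz hF]⟩
  · rintro ⟨a, ha, b, hb, hab, h⟩
    obtain ⟨x, rfl⟩ := exists_code_eq hz hF (hl _ ha)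
    obtain ⟨y, rfl⟩ := exists_code_eq hz hF (hl _ hb)
    refine ⟨x, ha, y, hb, fun e => hab (by rw [e]), code_injective hz hF ?_⟩
    rw [h, code_mul hz hF, code_inv hz hF]

theorem ncard_toSet {l : List M8} (hn : l.Nodup) (hl : ∀ x ∈ l, x.det = K8.X 0) :
    (toSet z l).ncard = l.length := by
  have h : code z '' toSet z l = (l.toFinset : Set M8) := by
    ext c
    simp only [toSet, Set.mem_image, Set.mem_ofPred_eq, List.coe_toFinset]
    constructor
    · rintro ⟨x, hx, rfl⟩
      exact hx
    · intro hc
      obtain ⟨x, rfl⟩ := exists_code_eq hz hF (hl _ hc)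
      exact ⟨x, hc, rfl⟩
  rw [← Set.ncard_image_of_injective _ (code_injective hz hF), h, Set.ncard_coe_finset,
    List.toFinset_card_of_nodup hn]

/-- A system of lists of codes defines an affine unital if the sets of quotients form a
partition of the elements of nonzero trace. -/
theorem isAffineUnital_of_lists {L : List (List M8)}
    (h1 : ∀ l ∈ L, l.Nodup ∧ l.length = 9 ∧ 1 ∈ l ∧ ∀ x ∈ l, x.det = K8.X 0)
    (h2 : (M8.cover L).Nodup) (h3 : ∀ x ∈ M8.cover L, x.a ≠ x.d)
    (h4 : ∀ x : M8, x.det = K8.X 0 → x.a ≠ x.d → x ∈ M8.cover L) :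
    IsAffineUnital 2 (C z hz) {D | ∃ l ∈ L, D = toSet z l} := by
  have hfin : Finite F := Nat.finite_of_card_ne_zero (by rw [hF]; decide)
  -- The distinctness splits into distinctness within each part, which gives (Q), and disjointness
  -- of different parts, which gives (P).
  rw [M8.cover, List.nodup_flatten] at h2
  obtain ⟨h2, h5⟩ := h2
  rw [List.pairwise_cons] at h5
  have hC : ∀ x : SL(2, F), x ∈ (C z hz : Set SL(2, F)) \ {1} ↔ code z x ∈ M8.listC.tail := by
    intro x
    have e : M8.listC = 1 :: M8.listC.tail := rfl
    have h1 : (1 : M8) ∉ M8.listC.tail := by decide +kernel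
    rw [coe_C hz hF, Set.mem_sdiff, toSet, Set.mem_ofPred_eq, e, List.mem_cons, Set.mem_singleton_iff,
      ← (code_injective hz hF).eq_iff, code_one hz hF, List.tail_cons]
    constructor
    · rintro ⟨h | h, h'⟩
      · exact absurd h h'
      · exact h
    · exact fun h => ⟨Or.inr h, fun h' => h1 (h' ▸ h)⟩
  have hCcover : ∀ x : SL(2, F), x ∈ (C z hz : Set SL(2, F)) \ {1} → code z x ∈ M8.cover L :=
    fun x hx => List.mem_flatten.2 ⟨_, List.mem_cons_self, (hC x).1 hx⟩
  have hDcover : ∀ l ∈ L, ∀ x ∈ star (toSet z l), code z x ∈ M8.cover L := by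
    intro l hl x hx
    rw [star_toSet hz hF (h1 l hl).2.2.2] at hx
    exact List.mem_flatten.2 ⟨_, List.mem_cons_of_mem _ (List.mem_map_of_mem hl), hx⟩
  have hnT : ∀ (T : Sylow 2 SL(2, F)) (x : SL(2, F)), x ∈ T → code z x ∉ M8.cover L :=
    fun T x hx hc => h3 _ hc ((trace_eq_zero_iff_code hz hF x).1 (trace_eq_zero_of_mem_sylow hx))
  have hCD : ∀ l ∈ L, ∀ x ∈ (C z hz : Set SL(2, F)) \ {1}, x ∉ star (toSet z l) := by
    intro l hl x hx hx'
    rw [star_toSet hz hF (h1 l hl).2.2.2] at hx'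
    exact h5.1 _ (List.mem_map_of_mem hl) ((hC x).1 hx) hx'
  have hDD : ∀ l ∈ L, ∀ l' ∈ L, l ≠ l' → ∀ x ∈ star (toSet z l), x ∉ star (toSet z l') := by
    intro l hl l' hl' hne x hx hx'
    rw [star_toSet hz hF (h1 l hl).2.2.2] at hx
    rw [star_toSet hz hF (h1 l' hl').2.2.2] at hx'
    have h6 := List.pairwise_map.1 h5.2
    have : Std.Symm fun a b => (M8.starList a).Disjoint (M8.starList b) := ⟨fun _ _ h => h.symm⟩
    exact h6.forall hl hl' hne hx hx'
  refine ⟨?_, ?_, ?_, ?_, ?_, ?_, ?_⟩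
  · rw [card_C hz hF, hF]
  · rintro _ ⟨l, hl, rfl⟩
    change code z 1 ∈ l
    rw [code_one hz hF]
    exact (h1 l hl).2.2.1
  · rintro _ ⟨l, hl, rfl⟩
    rw [hF, ncard_toSet hz hF (h1 l hl).1 (h1 l hl).2.2.2, (h1 l hl).2.1]
  · rintro _ ⟨l, hl, rfl⟩ ⟨x, y⟩ hxy ⟨x', y'⟩ hxy' h
    have hn := h2 _ (List.mem_cons_of_mem _ (List.mem_map_of_mem hl))
    have hmem : ∀ u v : SL(2, F), (u, v) ∈ (toSet z l).offDiag →
        (code z u, code z v) ∈ (l ×ˢ l).filter fun w => w.1 ≠ w.2 := by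
      rintro u v ⟨hu, hv, huv⟩
      exact List.mem_filter.2 ⟨List.mem_product.2 ⟨hu, hv⟩,
        decide_eq_true ((code_injective hz hF).ne huv)⟩
    have h6 := List.inj_on_of_nodup_map hn (hmem x y hxy) (hmem x' y' hxy') (by
      have h7 := congrArg (code z) h
      simpa only [code_mul hz hF, code_inv hz hF] using h7)
    rw [Prod.mk.injEq] at h6 ⊢
    exact ⟨code_injective hz hF h6.1, code_injective hz hF h6.2⟩
  · rintro (_ | T | ⟨_, l, hl, rfl⟩)
    · refine ⟨g z hz, Subgroup.mem_zpowers _, fun h => ?_⟩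
      have := orderOf_g hz hF
      rw [Set.mem_singleton_iff.1 h, orderOf_one] at this
      omega
    · obtain ⟨x, hx, hx1⟩ := exists_ne_one_mem_sylow T
      exact ⟨x, hx, hx1⟩
    · have hc : 1 < (toSet z l).ncard := by
        rw [ncard_toSet hz hF (h1 l hl).1 (h1 l hl).2.2.2, (h1 l hl).2.1]
        norm_num
      obtain ⟨x, hx, y, hy, hxy⟩ := (Set.one_lt_ncard (Set.toFinite _)).1 hc
      exact ⟨x * y⁻¹, x, hx, y, hy, hxy, rfl⟩
  · rintro (_ | T | ⟨_, l, hl, rfl⟩) (_ | T' | ⟨_, l', hl', rfl⟩) hne <;>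
      rw [Set.disjoint_left] <;> intro x hx hx'
    · exact hne rfl
    · exact hnT T' x hx'.1 (hCcover x hx)
    · exact hCD l' hl' x hx hx'
    · exact hnT T x hx.1 (hCcover x hx')
    · exact hne (by rw [sylow_eq_of_mem hx.2 hx.1 hx'.1])
    · exact hnT T x hx.1 (hDcover l' hl' x hx')
    · exact hCD l hl x hx' hx
    · exact hnT T' x hx'.1 (hDcover l hl x hx)
    · refine hDD l hl l' hl' (fun e => hne ?_) x hx hx'
      subst e
      rfl
  · ext x
    simp only [Set.mem_iUnion, Set.mem_compl_iff, Set.mem_singleton_iff]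
    constructor
    · rintro ⟨_ | T | ⟨_, l, hl, rfl⟩, hx⟩ h
      · exact hx.2 h
      · exact hx.2 h
      · obtain ⟨u, -, v, -, huv, rfl⟩ := hx
        exact huv (mul_inv_eq_one.1 h)
    · intro hx
      by_cases ht : tr x = 0
      · obtain ⟨T, hT⟩ := exists_sylow_of_trace_eq_zero ht
        exact ⟨.inr (.inl T), hT, hx⟩
      · have h6 := h4 (code z x) (det_code hz hF x) fun h =>
          ht ((trace_eq_zero_iff_code hz hF x).2 h)
        obtain ⟨m, hm, hxm⟩ := List.mem_flatten.1 h6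
        rcases List.mem_cons.1 hm with rfl | hm
        · exact ⟨.inl (), (hC x).2 hxm⟩
        · obtain ⟨l, hl, rfl⟩ := List.mem_map.1 hm
          refine ⟨.inr (.inr ⟨_, l, hl, rfl⟩), ?_⟩
          change x ∈ star (toSet z l)
          rw [star_toSet hz hF (h1 l hl).2.2.2]
          exact hxm

end

end AffineSL2

/-! ### Finite checks on the arcuate blocks and on `C` -/

namespace AffineSL2

open Matrix Matrix.SpecialLinearGroup

namespace M8

/-- Each list, transformed by `m`, has the same entries as a right translate of one of the lists. -/
def Stable (m : M8 → M8) (L : List (List M8)) : Prop :=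
  ∀ l ∈ L, ∃ l' ∈ L, ∃ h ∈ l', (∀ x ∈ l.map m, x ∈ mulList l' h.adj) ∧
    ∀ x ∈ mulList l' h.adj, x ∈ l.map m

instance (m : M8 → M8) (L : List (List M8)) : Decidable (Stable m L) := by
  unfold Stable
  infer_instance

/-- The transformed list contains `1`, so a translate of `l'` equal to it is `l' h⁻¹` with `h ∈ l'`;
only such translates need testing. The content here is that conjugating the third list of an orbit
gives a block again. -/
theorem stable_conj_O : Stable (fun x => g.adj * x * g) listsO := by decide +kernel

theorem stable_conj_P : Stable (fun x => g.adj * x * g) listsP := by decide +kernel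

theorem stable_frob_O : Stable frob listsO := by decide +kernel

theorem stable_frob_P : Stable frob listsP := by decide +kernel

/-- A criterion for a list not to consist of the entries of a block. -/
def NotBlock (l : List M8) (L : List (List M8)) : Prop :=
  ∃ u ∈ starList l, ∃ v ∈ starList l, u.a ≠ u.d ∧ u ∉ listC ∧
    ∀ l' ∈ L, ¬ (u ∈ starList l' ∧ v ∈ starList l')

instance (l : List M8) (L : List (List M8)) : Decidable (NotBlock l L) := by
  unfold NotBlock
  infer_instance

/-- Right translation does not change the set of quotients, so no translates have to be enumerated:
`u` rules out Sylow blocks and translates of `C`, and the pair `u`, `v` rules out the arcuate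
blocks. -/
theorem notBlock_D₄ : NotBlock listD₄ listsP := by decide +kernel

theorem notBlock_conj_f : NotBlock (listD₁.map fun x => f * x * f.adj) (listsO ++ listsP) := by
  decide +kernel

theorem notBlock_adj : NotBlock (listD₁.map adj) (listsO ++ listsP) := by decide +kernel

theorem notBlock_adj_conj_f :
    NotBlock (listD₁.map fun x => (f * x * f.adj).adj) (listsO ++ listsP) := by
  decide +kernel

/-- The exponents 7 and 8 here and in `conj_f_g` generate the units modulo 9. -/
theorem frob_g : frob g = gPow 7 := by decide +kernel

theorem conj_f_g : f * g * f.adj = gPow 8 := by decide +kernel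

/-- The first columns of the powers of `g` represent all points of the projective line, which makes
`C` transitive. -/
theorem gPow_col (u v : K8) : ∃ n < 9, (gPow n).a * v = (gPow n).c * u := by
  have h : ∀ u ∈ K8.all, ∀ v ∈ K8.all, ∃ n < 9, (gPow n).a * v = (gPow n).c * u := by
    decide +kernel
  exact h u (K8.mem_all _) v (K8.mem_all _)

end M8

end AffineSL2

/-! ### Isomorphisms of incidence structures -/

namespace IncidenceStructure

variable {P Q R : Type*}

theorem IsIsomorphism.image_mem {U : IncidenceStructure P} {V : IncidenceStructure Q} {ψ : P ≃ Q}
    (h : U.IsIsomorphism V ψ) {b : Set P} (hb : b ∈ U.blocks) : ψ '' b ∈ V.blocks :=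
  (isIsomorphism_iff U V ψ |>.1 h b).1 hb

theorem IsIsomorphism.symm {U : IncidenceStructure P} {V : IncidenceStructure Q} {ψ : P ≃ Q}
    (h : U.IsIsomorphism V ψ) : V.IsIsomorphism U ψ.symm := by
  rw [isIsomorphism_iff] at *
  intro b
  rw [h, Equiv.image_symm_image]

theorem IsIsomorphism.trans {U : IncidenceStructure P} {V : IncidenceStructure Q}
    {W : IncidenceStructure R} {ψ : P ≃ Q} {χ : Q ≃ R} (h : U.IsIsomorphism V ψ)
    (h' : V.IsIsomorphism W χ) : U.IsIsomorphism W (ψ.trans χ) := by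
  rw [isIsomorphism_iff] at *
  intro b
  rw [h, h', Set.image_image]
  rfl

theorem mem_Aut_iff {U : IncidenceStructure P} {ψ : Equiv.Perm P} :
    ψ ∈ U.Aut ↔ U.IsIsomorphism U ψ := Iff.rfl

theorem mem_Aut_of_image_mem [Finite P] {U : IncidenceStructure P} {ψ : Equiv.Perm P}
    (h : ∀ b ∈ U.blocks, ψ '' b ∈ U.blocks) : ψ ∈ U.Aut := by
  refine Set.eq_of_subset_of_ncard_le (Set.image_subset_iff.2 h) ?_ (Set.toFinite _)
  rw [Set.ncard_image_of_injective _ ψ.injective.image_injective]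

end IncidenceStructure

/-! ### Translates, and what isomorphisms of unitals preserve -/

namespace AffineSL2

open Matrix Matrix.SpecialLinearGroup IncidenceStructure
open scoped Pointwise

section Translate

variable {G : Type*} [Group G]

theorem rightTranslate_rightTranslate (B : Set G) (a b : G) :
    rightTranslate (rightTranslate B a) b = rightTranslate B (a * b) := by
  simp only [rightTranslate, Set.image_image, mul_assoc]

theorem ncard_rightTranslate (B : Set G) (a : G) : (rightTranslate B a).ncard = B.ncard :=
  Set.ncard_image_of_injective _ (mul_left_injective a)

theorem mem_rightTranslate {B : Set G} {a x : G} : x ∈ rightTranslate B a ↔ x * a⁻¹ ∈ B := by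
  constructor
  · rintro ⟨y, hy, rfl⟩
    simpa using hy
  · intro h
    exact ⟨_, h, by simp⟩

theorem star_rightTranslate (B : Set G) (a : G) : star (rightTranslate B a) = star B := by
  ext w
  constructor
  · rintro ⟨_, ⟨x, hx, rfl⟩, _, ⟨y, hy, rfl⟩, hxy, rfl⟩
    exact ⟨x, hx, y, hy, fun h => hxy (by rw [h]), by simp [mul_assoc]⟩
  · rintro ⟨x, hx, y, hy, hxy, rfl⟩
    refine ⟨x * a, ⟨x, hx, rfl⟩, y * a, ⟨y, hy, rfl⟩, fun h => hxy (mul_right_cancel h), ?_⟩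
    simp [mul_assoc]

theorem image_rightTranslate (e : G ≃* G) (B : Set G) (a : G) :
    e '' rightTranslate B a = rightTranslate (e '' B) (e a) := by
  simp only [rightTranslate, Set.image_image, map_mul]

end Translate

section Unital

variable {F : Type*} [Field F]

theorem mulRight_mem_Aut [Finite F] (p : ℕ) (S : Subgroup SL(2, F)) (𝒟 : Set (Set SL(2, F)))
    (a : SL(2, F)) : Equiv.mulRight a ∈ (unital p S 𝒟).Aut := by
  refine mem_Aut_of_image_mem ?_
  rintro b ⟨h, hb⟩
  refine ⟨h * a, ?_⟩
  change rightTranslate b a = _ ∨ (∃ T : Sylow p SL(2, F), rightTranslate b a = _) ∨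
    ∃ D ∈ 𝒟, rightTranslate b a = _
  rcases hb with rfl | ⟨T, rfl⟩ | ⟨D, hD, rfl⟩
  · exact Or.inl (rightTranslate_rightTranslate _ _ _)
  · exact Or.inr (Or.inl ⟨T, rightTranslate_rightTranslate _ _ _⟩)
  · exact Or.inr (Or.inr ⟨D, hD, rightTranslate_rightTranslate _ _ _⟩)

/-- Group automorphisms permute the Sylow subgroups, so only `S` and the arcuate blocks need
hypotheses. -/
theorem toPerm_mem_Aut [Finite F] (p : ℕ) [Fact p.Prime] {S : Subgroup SL(2, F)}
    {𝒟 : Set (Set SL(2, F))} (e : MulAut SL(2, F)) (hS : S.map e.toMonoidHom = S)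
    (hD : ∀ D ∈ 𝒟, ∃ D' ∈ 𝒟, ∃ a, e '' D = rightTranslate D' a) :
    e.toEquiv ∈ (unital p S 𝒟).Aut := by
  refine mem_Aut_of_image_mem ?_
  rintro b ⟨h, hb⟩
  change ∃ g, e '' b = _ ∨ (∃ T : Sylow p SL(2, F), e '' b = _) ∨ ∃ D ∈ 𝒟, e '' b = _
  rcases hb with rfl | ⟨T, rfl⟩ | ⟨D, hD', rfl⟩
  · refine ⟨e h, Or.inl ?_⟩
    rw [image_rightTranslate]
    congr 1
    exact congrArg (fun H : Subgroup SL(2, F) => (H : Set SL(2, F))) hS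
  · refine ⟨e h, Or.inr (Or.inl ⟨e • T, ?_⟩)⟩
    rw [image_rightTranslate]
    rfl
  · obtain ⟨D', hD1, a, ha⟩ := hD D hD'
    refine ⟨a * e h, Or.inr (Or.inr ⟨D', hD1, ?_⟩)⟩
    rw [image_rightTranslate, ha, rightTranslate_rightTranslate]

variable [CharP F 2]

/-- Block size is preserved, and only Sylow blocks do not have 9 points. -/
theorem perp_image [Finite F] {S S' : Subgroup SL(2, F)} {𝒟 𝒟' : Set (Set SL(2, F))}
    (hF : Nat.card F = 8) (h' : IsAffineUnital 2 S' 𝒟')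
    {ψ : Equiv.Perm SL(2, F)} (hψ : (unital 2 S 𝒟).IsIsomorphism (unital 2 S' 𝒟') ψ)
    {x y : SL(2, F)} (hxy : Perp x y) : Perp (ψ x) (ψ y) := by
  obtain ⟨T, hT⟩ := (perp_iff_exists_sylow x y).1 hxy
  have hb : rightTranslate (T : Set SL(2, F)) y ∈ (unital 2 S 𝒟).blocks :=
    ⟨y, Or.inr (Or.inl ⟨T, rfl⟩)⟩
  have hx : ψ x ∈ ψ '' rightTranslate (T : Set SL(2, F)) y :=
    Set.mem_image_of_mem _ (mem_rightTranslate.2 hT)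
  have hy : ψ y ∈ ψ '' rightTranslate (T : Set SL(2, F)) y :=
    Set.mem_image_of_mem _ (mem_rightTranslate.2 (by rw [mul_inv_cancel]; exact T.one_mem))
  have hc : (ψ '' rightTranslate (T : Set SL(2, F)) y).ncard ≠ 9 := by
    rw [Set.ncard_image_of_injective _ ψ.injective, ncard_rightTranslate]
    exact ncard_sylow_ne T
  obtain ⟨a, hb' | ⟨T', hb'⟩ | ⟨D, hD, hb'⟩⟩ := hψ.image_mem hb
  · rw [hb', ncard_rightTranslate, ← Nat.card_coe_set_eq] at hc
    exact absurd (h'.card_S.trans (by rw [hF])) hc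
  · rw [hb', mem_rightTranslate] at hx hy
    rw [perp_iff_exists_sylow]
    refine ⟨T', ?_⟩
    have := T'.mul_mem hx (T'.inv_mem hy)
    simp only [_root_.mul_inv_rev, inv_inv, mul_assoc, inv_mul_cancel_left] at this
    exact this
  · rw [hb', ncard_rightTranslate, h'.card_D D hD, hF] at hc
    exact absurd rfl hc

theorem perp_iff_of_isIsomorphism [Finite F] {S S' : Subgroup SL(2, F)}
    {𝒟 𝒟' : Set (Set SL(2, F))} (hF : Nat.card F = 8) (h : IsAffineUnital 2 S 𝒟)
    (h' : IsAffineUnital 2 S' 𝒟') {ψ : Equiv.Perm SL(2, F)}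
    (hψ : (unital 2 S 𝒟).IsIsomorphism (unital 2 S' 𝒟') ψ) (x y : SL(2, F)) :
    Perp (ψ x) (ψ y) ↔ Perp x y := by
  refine ⟨fun hxy => ?_, perp_image hF h' hψ⟩
  simpa using perp_image hF h hψ.symm hxy

/-- The image of the subgroup `S` under an isomorphism fixing `1`. -/
theorem map_mem_of_isIsomorphism [Finite F] {S S' : Subgroup SL(2, F)}
    {𝒟 𝒟' : Set (Set SL(2, F))} (hF : Nat.card F = 8) (h : IsAffineUnital 2 S 𝒟)
    (h' : IsAffineUnital 2 S' 𝒟') {ψ : Equiv.Perm SL(2, F)}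
    (hψ : (unital 2 S 𝒟).IsIsomorphism (unital 2 S' 𝒟') ψ) (h1 : ψ 1 = 1) {x : SL(2, F)}
    (hx : x ∈ S) : ψ x ∈ S' := by
  have hb : (S : Set SL(2, F)) ∈ (unital 2 S 𝒟).blocks :=
    ⟨1, Or.inl (by simp [rightTranslate])⟩
  by_cases hx1 : x = 1
  · rw [hx1, h1]
    exact S'.one_mem
  have hy1 : ψ x ≠ 1 := fun e => hx1 (ψ.injective (e.trans h1.symm))
  have hc : (ψ '' (S : Set SL(2, F))).ncard = 9 := by
    rw [Set.ncard_image_of_injective _ ψ.injective, ← Nat.card_coe_set_eq]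
    exact h.card_S.trans (by rw [hF])
  have h2 : ψ (x * x) = ψ x * ψ x := by
    rcases map_mul_or_map_mul_rev ψ (perp_iff_of_isIsomorphism hF h h' hψ) h1 with H | H <;>
      exact H x x
  have m0 : (1 : SL(2, F)) ∈ ψ '' (S : Set SL(2, F)) := ⟨1, S.one_mem, h1⟩
  have m1 : ψ x ∈ ψ '' (S : Set SL(2, F)) := ⟨x, hx, rfl⟩
  have m2 : ψ x * ψ x ∈ ψ '' (S : Set SL(2, F)) := ⟨x * x, S.mul_mem hx hx, h2⟩
  obtain ⟨a, hb' | ⟨T', hb'⟩ | ⟨D, hD, hb'⟩⟩ := hψ.image_mem hb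
  · rw [hb', mem_rightTranslate] at m0 m1
    have := S'.mul_mem m1 (S'.inv_mem m0)
    simpa using this
  · rw [hb', ncard_rightTranslate] at hc
    exact absurd hc (ncard_sylow_ne T')
  · rw [hb', mem_rightTranslate] at m0 m1 m2
    -- `ψ` respects squares, so `1`, `ψ x` and `(ψ x)²` lie on the image block. On an arcuate block
    -- the quotient `ψ x` would arise from two different pairs, against (Q).
    have e := h'.injOn D hD (x₁ := (ψ x * a⁻¹, 1 * a⁻¹)) (x₂ := (ψ x * ψ x * a⁻¹, ψ x * a⁻¹))
      ⟨m1, m0, fun e => hy1 (mul_right_cancel e)⟩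
      ⟨m2, m1, fun e => hy1 (by simpa using mul_right_cancel e)⟩
      (by simp [mul_assoc])
    rw [Prod.mk.injEq] at e
    exact absurd (mul_right_cancel e.2).symm hy1

end Unital

end AffineSL2

/-! ### Automorphisms normalizing `C`, and the blocks as lists -/

namespace AffineSL2

open Matrix Matrix.SpecialLinearGroup IncidenceStructure

section

variable {F : Type*} [Field F]

theorem trace_mulAut_conj (h x : SL(2, F)) : tr (MulAut.conj h x) = tr x := by
  rw [MulAut.conj_apply, trace_mul_comm, inv_mul_cancel_left]

variable [CharP F 2]

/-- The Frobenius automorphism, applied to the entries of a matrix. -/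
noncomputable def frob (F : Type*) [Field F] [CharP F 2] [Finite F] : MulAut SL(2, F) :=
  MulEquiv.ofBijective (Matrix.SpecialLinearGroup.map (frobenius F 2)) <| by
    refine Finite.injective_iff_bijective.1 fun x y h => ?_
    ext i j
    refine frobenius_inj F 2 ?_
    exact congrFun₂ (congrArg Subtype.val h) i j

theorem frob_apply [Finite F] (x : SL(2, F)) (i j : Fin 2) : frob F x i j = x i j ^ 2 := rfl

theorem trace_frob_eq_zero_iff [Finite F] (x : SL(2, F)) : tr (frob F x) = 0 ↔ tr x = 0 := by
  rw [tr_def, tr_def, frob_apply, frob_apply, ← CharTwo.add_sq, sq_eq_zero_iff]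

variable {z : F} (hz : z ^ 3 = z + 1) (hF : Nat.card F = 8)
include hz hF

theorem code_frob [Finite F] (x : SL(2, F)) : code z (frob F x) = (code z x).frob := by
  rw [code_eq_iff hz hF]
  ext i j
  rw [frob_apply, ← val_code hz hF x]
  fin_cases i <;> fin_cases j <;> simp [M8.val, M8.frob, K8.val_mul hz, sq]

theorem frob_g [Finite F] : frob F (g z hz) = g z hz ^ 7 := by
  apply code_injective hz hF
  rw [code_frob hz hF, code_g hz hF, code_g_pow hz hF, M8.frob_g]

theorem conj_f_g : MulAut.conj (f F) (g z hz) = g z hz ^ 8 := by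
  apply code_injective hz hF
  rw [MulAut.conj_apply, code_mul hz hF, code_mul hz hF, code_inv hz hF, code_f hz hF,
    code_g hz hF, code_g_pow hz hF, M8.conj_f_g]

theorem g_pow_transitive (A B : Line F) : ∃ k : ℕ, g z hz ^ k • A = B := by
  have key : ∀ A : Line F, ∃ k < 9, g z hz ^ k • lineInfty F = A := by
    intro A
    induction A using Projectivization.ind with
    | h v hv =>
      obtain ⟨u, hu⟩ := (K8.val_bijective hz hF).2 (v 0)
      obtain ⟨w, hw⟩ := (K8.val_bijective hz hF).2 (v 1)
      obtain ⟨n, hn, h⟩ := M8.gPow_col u w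
      refine ⟨n, hn, ?_⟩
      rw [lineInfty, smul_mk_eq_mk_iff, ← val_code hz hF, code_g_pow hz hF, ← hu, ← hw]
      simp [M8.val, ← K8.val_mul hz, h]
  obtain ⟨i, hi, rfl⟩ := key A
  obtain ⟨j, -, rfl⟩ := key B
  refine ⟨j + (9 - i), ?_⟩
  rw [smul_smul, ← pow_add, add_assoc, Nat.sub_add_cancel hi.le, pow_add, g_pow_nine hz hF,
    mul_one]

/-- The automorphisms of `SL(2,F)` that preserve orthogonality and normalize `C`. -/
theorem eq_of_map_mul [Finite F] (ψ : Equiv.Perm SL(2, F))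
    (hψ : ∀ x y, Perp (ψ x) (ψ y) ↔ Perp x y) (hm : ∀ x y, ψ (x * y) = ψ x * ψ y)
    (hg : ψ (g z hz) ∈ C z hz) : ∃ (i j k : ℕ), j < 2 ∧
      ∀ x, ψ x = (MulAut.conj (f F) ^ j * frob F ^ i * MulAut.conj (g z hz) ^ k) x := by
  obtain ⟨n, hn, hgn⟩ := (mem_C_iff_pow hz hF _).1 hg
  have h1 : ψ 1 = 1 := by simpa using hm 1 1
  have hpow : ∀ m : ℕ, ψ (g z hz ^ m) = g z hz ^ (n * m) := by
    intro m
    induction m with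
    | zero => simpa using h1
    | succ m ih => rw [pow_succ, hm, ih, ← hgn, ← pow_add, mul_add, mul_one]
  have h9 : ∀ a b : ℕ, g z hz ^ a = g z hz ^ b ↔ a % 9 = b % 9 := by
    intro a b
    rw [pow_eq_pow_iff_modEq, orderOf_g hz hF]
    rfl
  -- Otherwise `g ^ 3 ≠ 1` would be mapped to `1`.
  have h3 : ¬ 3 ∣ n := by
    rintro ⟨m, rfl⟩
    have h4 := hpow 3
    rw [show 3 * m * 3 = 9 * m by ring, pow_mul, g_pow_nine hz hF, one_pow, ← h1] at h4
    have h5 := (h9 3 0).1 (by rw [pow_zero]; exact ψ.injective h4)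
    omega
  obtain ⟨i, j, hj, hij⟩ : ∃ i j : ℕ, j < 2 ∧
      (MulAut.conj (f F) ^ j * frob F ^ i) (g z hz) = g z hz ^ n := by
    have hn' : n = 1 ∨ n = 7 ∨ n = 4 ∨ n = 8 ∨ n = 2 ∨ n = 5 := by omega
    have e1 := frob_g hz hF
    have e2 : frob F (frob F (g z hz)) = g z hz ^ 4 := by
      rw [e1, map_pow, e1, ← pow_mul, h9]
    have e3 := conj_f_g hz hF
    rcases hn' with rfl | rfl | rfl | rfl | rfl | rfl
    · exact ⟨0, 0, by norm_num, by simp⟩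
    · exact ⟨1, 0, by norm_num, by simpa using e1⟩
    · exact ⟨2, 0, by norm_num, by rw [← e2]; rfl⟩
    · exact ⟨0, 1, by norm_num, by rw [← e3]; simp⟩
    · refine ⟨1, 1, by norm_num, ?_⟩
      rw [pow_one, pow_one, MulAut.mul_apply, e1, map_pow, e3, ← pow_mul, h9]
    · refine ⟨2, 1, by norm_num, ?_⟩
      rw [pow_one, MulAut.mul_apply, sq, MulAut.mul_apply, e2, map_pow, e3, ← pow_mul, h9]
  set χ : MulAut SL(2, F) := MulAut.conj (f F) ^ j * frob F ^ i with hχ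
  have hχt : ∀ x, tr (χ x) = 0 ↔ tr x = 0 := by
    intro x
    have h4 : ∀ (j : ℕ) y, tr ((MulAut.conj (f F) ^ j) y) = tr y := by
      intro j y
      rw [← map_pow, trace_mulAut_conj]
    rw [hχ, MulAut.mul_apply, h4]
    clear_value χ
    clear hij hχ
    induction i generalizing x with
    | zero => rfl
    | succ i ih => 
      rw [pow_succ, MulAut.mul_apply]
      exact (ih _).trans (trace_frob_eq_zero_iff x)
  have hχp := perp_map χ hχt
  -- `χ` agrees with `ψ` on `g`, so `χ⁻¹ ∘ ψ` centralizes `C`.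
  obtain ⟨k, hk⟩ := exists_conj_of_centralizes (ψ.trans χ.symm.toEquiv)
    (fun x y => (hχp _ _).symm.trans (by simpa using hψ x y))
    (fun x y => by simp [hm]) (g z hz) (g_pow_transitive hz hF)
    (by
      change χ.symm (ψ (g z hz)) = g z hz
      rw [← hgn, ← hij, MulEquiv.symm_apply_apply])
  refine ⟨i, j, k, hj, fun x => ?_⟩
  have h4 := hk x
  change χ.symm (ψ x) = _ at h4
  rw [MulEquiv.symm_apply_eq] at h4
  rw [MulAut.mul_apply, ← map_pow MulAut.conj (g z hz), MulAut.conj_apply, ← hχ, h4]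

theorem image_toSet {φ : SL(2, F) → SL(2, F)} {m : M8 → M8} (h : ∀ x, code z (φ x) = m (code z x))
    {l : List M8} (hl : ∀ x ∈ l, x.det = K8.X 0) : φ '' toSet z l = toSet z (l.map m) := by
  ext y
  simp only [toSet, Set.mem_image, Set.mem_ofPred_eq, List.mem_map]
  constructor
  · rintro ⟨x, hx, rfl⟩
    exact ⟨_, hx, (h x).symm⟩
  · rintro ⟨c, hc, hy⟩
    obtain ⟨x, rfl⟩ := exists_code_eq hz hF (hl c hc)
    exact ⟨x, hc, code_injective hz hF ((h x).trans hy)⟩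

theorem conj_toSet {h : SL(2, F)} {c : M8} (hc : code z h = c) {l : List M8}
    (hl : ∀ x ∈ l, x.det = K8.X 0) : conj (toSet z l) h = toSet z (M8.conjList c l) :=
  image_toSet hz hF (m := fun x => c.adj * x * c)
    (fun x => by rw [code_mul hz hF, code_mul hz hF, code_inv hz hF, hc]) hl

theorem D₁_eq : D₁ z = toSet z M8.listD₁ := by
  ext x
  simp only [D₁, ofMatrices, toSet, M8.listD₁, Set.mem_ofPred_eq, Set.mem_insert_iff,
    Set.mem_singleton_iff, List.mem_cons, List.not_mem_nil, or_false, code_eq_iff hz hF]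
  rw [← code_one hz hF, val_code hz hF, coe_one]
  simp only [M8.val, K8.val_X hz, K8.val_zero, pow_zero, pow_one]

theorem D₄_eq : D₄ z = toSet z M8.listD₄ := by
  ext x
  simp only [D₄, ofMatrices, toSet, M8.listD₄, Set.mem_ofPred_eq, Set.mem_insert_iff,
    Set.mem_singleton_iff, List.mem_cons, List.not_mem_nil, or_false, code_eq_iff hz hF]
  rw [← code_one hz hF, val_code hz hF, coe_one]
  simp only [M8.val, K8.val_X hz, K8.val_zero, pow_zero, pow_one]

theorem D₄'_eq : D₄' z = toSet z M8.listD₄' := by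
  rw [D₄', D₄_eq hz hF]
  exact conj_toSet hz hF (code_f hz hF) (M8.listsO_facts M8.listD₄ (by simp [M8.listsO, M8.orbit])).2.2.2

theorem orbit_eq {l : List M8} (hl : ∀ x ∈ l, x.det = K8.X 0) :
    {D | ∃ m ∈ M8.orbit l, D = toSet z m} =
      {toSet z l, conj (toSet z l) (g z hz), conj (toSet z l) (g z hz ^ 2)} := by
  rw [conj_toSet hz hF (code_g hz hF) hl, conj_toSet hz hF (c := M8.g * M8.g) (by
    rw [sq, code_mul hz hF, code_g hz hF]) hl]
  ext D
  simp [M8.orbit]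

theorem 𝒟O_eq : 𝒟O z hz = {D | ∃ l ∈ M8.listsO, D = toSet z l} := by
  have h1 := orbit_eq hz hF (l := M8.listD₁)
    (M8.listsO_facts M8.listD₁ (by simp [M8.listsO, M8.orbit])).2.2.2
  have h4 := orbit_eq hz hF (l := M8.listD₄)
    (M8.listsO_facts M8.listD₄ (by simp [M8.listsO, M8.orbit])).2.2.2
  rw [← D₁_eq hz hF] at h1
  rw [← D₄_eq hz hF] at h4
  ext D
  have h1' := Set.ext_iff.1 h1 D
  have h4' := Set.ext_iff.1 h4 D
  simp only [Set.mem_ofPred_eq, Set.mem_insert_iff, Set.mem_singleton_iff] at h1' h4'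
  simp only [𝒟O, M8.listsO, Set.mem_ofPred_eq, List.mem_append, or_and_right, exists_or, h1', h4',
    Set.mem_insert_iff, Set.mem_singleton_iff, or_assoc]

theorem 𝒟P_eq : 𝒟P z hz = {D | ∃ l ∈ M8.listsP, D = toSet z l} := by
  have h1 := orbit_eq hz hF (l := M8.listD₁)
    (M8.listsP_facts M8.listD₁ (by simp [M8.listsP, M8.orbit])).2.2.2
  have h4 := orbit_eq hz hF (l := M8.listD₄')
    (M8.listsP_facts M8.listD₄' (by simp [M8.listsP, M8.orbit])).2.2.2
  rw [← D₁_eq hz hF] at h1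
  rw [← D₄'_eq hz hF] at h4
  ext D
  have h1' := Set.ext_iff.1 h1 D
  have h4' := Set.ext_iff.1 h4 D
  simp only [Set.mem_ofPred_eq, Set.mem_insert_iff, Set.mem_singleton_iff] at h1' h4'
  simp only [𝒟P, M8.listsP, Set.mem_ofPred_eq, List.mem_append, or_and_right, exists_or, h1', h4',
    Set.mem_insert_iff, Set.mem_singleton_iff, or_assoc]

theorem isAffineUnital_O : IsAffineUnital 2 (C z hz) (𝒟O z hz) := by
  rw [𝒟O_eq hz hF]
  exact isAffineUnital_of_lists hz hF M8.listsO_facts (M8.nodup_of_fresh M8.fresh_coverO)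
    M8.coverO_diag (M8.mem_of_covers M8.covers_coverO)

theorem isAffineUnital_P : IsAffineUnital 2 (C z hz) (𝒟P z hz) := by
  rw [𝒟P_eq hz hF]
  exact isAffineUnital_of_lists hz hF M8.listsP_facts (M8.nodup_of_fresh M8.fresh_coverP)
    M8.coverP_diag (M8.mem_of_covers M8.covers_coverP)

theorem toPerm_mem_Aut_of_stable [Finite F] {L : List (List M8)} (e : MulAut SL(2, F))
    (m : M8 → M8) (he : ∀ x, code z (e x) = m (code z x)) (hg : e (g z hz) ∈ C z hz)
    (hL : ∀ l ∈ L, l.Nodup ∧ l.length = 9 ∧ 1 ∈ l ∧ ∀ x ∈ l, x.det = K8.X 0)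
    (hs : M8.Stable m L) :
    e.toEquiv ∈ (unital 2 (C z hz) {D | ∃ l ∈ L, D = toSet z l}).Aut := by
  refine toPerm_mem_Aut 2 e ?_ ?_
  · refine Subgroup.eq_of_le_of_card_ge ?_ ?_
    · rw [C, MonoidHom.map_zpowers, Subgroup.zpowers_le]
      exact hg
    · exact (Nat.card_congr (Subgroup.equivMapOfInjective _ _ e.injective).toEquiv).le
  · rintro _ ⟨l, hl, rfl⟩
    obtain ⟨l', hl', h, hh, h1, h2⟩ := hs l hl
    obtain ⟨a, ha⟩ := exists_code_eq hz hF ((hL l' hl').2.2.2 h hh)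
    refine ⟨_, ⟨l', hl', rfl⟩, a⁻¹, ?_⟩
    rw [image_toSet hz hF he (hL l hl).2.2.2, rightTranslate,
      image_toSet hz hF (m := fun x => x * h.adj)
        (fun x => by rw [code_mul hz hF, code_inv hz hF, ha]) (hL l' hl').2.2.2]
    ext x
    exact ⟨h1 _, h2 _⟩

theorem toSet_notMem_blocks {l : List M8} {L : List (List M8)}
    (hl : ∀ x ∈ l, x.det = K8.X 0) (hL : ∀ l ∈ L, ∀ x ∈ l, x.det = K8.X 0)
    (h : M8.NotBlock l L) :
    toSet z l ∉ (unital 2 (C z hz) {D | ∃ l ∈ L, D = toSet z l}).blocks := by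
  obtain ⟨u, hu, v, hv, h1, h2, h3⟩ := h
  have hstar := star_toSet hz hF hl
  have hs : ∀ c ∈ M8.starList l, ∃ x ∈ star (toSet z l), code z x = c := by
    intro c hc
    obtain ⟨a, ha, b, hb, hab, rfl⟩ := M8.mem_starList.1 hc
    obtain ⟨x, rfl⟩ := exists_code_eq hz hF (hl _ ha)
    obtain ⟨y, rfl⟩ := exists_code_eq hz hF (hl _ hb)
    exact ⟨x * y⁻¹, ⟨x, ha, y, hb, fun e => hab (by rw [e]), rfl⟩, by
      rw [code_mul hz hF, code_inv hz hF]⟩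
  obtain ⟨x, hx, rfl⟩ := hs u hu
  obtain ⟨y, hy, rfl⟩ := hs v hv
  rintro ⟨a, hb | ⟨T, hb⟩ | ⟨_, ⟨l', hl', rfl⟩, hb⟩⟩ <;> rw [hb, star_rightTranslate] at hx hy
  · obtain ⟨p, hp, q, hq, -, rfl⟩ := hx
    exact h2 ((mem_C_iff hz hF _).1 (mul_mem hp (inv_mem hq)))
  · obtain ⟨p, hp, q, hq, -, rfl⟩ := hx
    exact h1 ((trace_eq_zero_iff_code hz hF _).1
      (trace_eq_zero_of_mem_sylow (T.mul_mem hp (T.inv_mem hq))))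
  · rw [star_toSet hz hF (hL l' hl')] at hx hy
    exact h3 l' hl' ⟨hx, hy⟩

end

end AffineSL2

/-! ### Determination of all isomorphisms -/

namespace AffineSL2

open Matrix Matrix.SpecialLinearGroup IncidenceStructure

theorem M8.NotBlock.mono {l : List M8} {L L' : List (List M8)} (h : M8.NotBlock l L)
    (hL : L' ⊆ L) : M8.NotBlock l L' := by
  obtain ⟨u, hu, v, hv, h1, h2, h3⟩ := h
  exact ⟨u, hu, v, hv, h1, h2, fun l' hl' => h3 l' (hL hl')⟩

theorem M8.det_listD₁ : ∀ x ∈ listD₁, x.det = K8.X 0 := by decide +kernel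

theorem M8.det_listD₄ : ∀ x ∈ listD₄, x.det = K8.X 0 := by decide +kernel

theorem M8.det_conj_f : ∀ x ∈ listD₁.map fun x => f * x * f.adj, x.det = K8.X 0 := by
  decide +kernel

theorem M8.det_adj : ∀ x ∈ listD₁.map adj, x.det = K8.X 0 := by decide +kernel

theorem M8.det_adj_conj_f : ∀ x ∈ listD₁.map fun x => (f * x * f.adj).adj, x.det = K8.X 0 := by
  decide +kernel

section

variable {F : Type*} [Field F] [CharP F 2] {z : F} (hz : z ^ 3 = z + 1) (hF : Nat.card F = 8)
include hz hF

/-- Conjugation by `g`, and the Frobenius automorphism, are automorphisms of both unitals. -/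
theorem toPerm_mem_Aut_inf [Finite F] (i k : ℕ) :
    (frob F ^ i * MulAut.conj (g z hz) ^ k).toEquiv ∈ (OU z hz).Aut ⊓ (PU z hz).Aut := by
  have hfrob : (frob F).toEquiv ∈ (OU z hz).Aut ⊓ (PU z hz).Aut := by
    have hg : frob F (g z hz) ∈ C z hz := by
      rw [frob_g hz hF]
      exact pow_mem (Subgroup.mem_zpowers _) 7
    rw [OU, PU, 𝒟O_eq hz hF, 𝒟P_eq hz hF]
    exact ⟨toPerm_mem_Aut_of_stable hz hF _ _ (code_frob hz hF) hg M8.listsO_facts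
        M8.stable_frob_O,
      toPerm_mem_Aut_of_stable hz hF _ _ (code_frob hz hF) hg M8.listsP_facts M8.stable_frob_P⟩
  -- The inverse appears because blocks are conjugated as `h⁻¹ B h`, while `MulAut.conj h` is `x ↦ h
  -- x h⁻¹`.
  have hconj : (MulAut.conj (g z hz)⁻¹).toEquiv ∈ (OU z hz).Aut ⊓ (PU z hz).Aut := by
    have hg : MulAut.conj (g z hz)⁻¹ (g z hz) ∈ C z hz := by
      simp only [MulAut.conj_apply, inv_mul_cancel, one_mul, inv_inv]
      exact Subgroup.mem_zpowers _
    have hc : ∀ x, code z (MulAut.conj (g z hz)⁻¹ x) = M8.g.adj * code z x * M8.g := by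
      intro x
      rw [MulAut.conj_apply, inv_inv, code_mul hz hF, code_mul hz hF, code_inv hz hF,
        code_g hz hF]
    rw [OU, PU, 𝒟O_eq hz hF, 𝒟P_eq hz hF]
    exact ⟨toPerm_mem_Aut_of_stable hz hF _ (fun x => M8.g.adj * x * M8.g) hc hg M8.listsO_facts
        M8.stable_conj_O,
      toPerm_mem_Aut_of_stable hz hF _ (fun x => M8.g.adj * x * M8.g) hc hg M8.listsP_facts
        M8.stable_conj_P⟩
  have e : (frob F ^ i * MulAut.conj (g z hz) ^ k).toEquiv =
      MulAut.toPerm _ (frob F) ^ i * (MulAut.toPerm _ (MulAut.conj (g z hz)⁻¹))⁻¹ ^ k := by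
    change MulAut.toPerm SL(2, F) (frob F ^ i * MulAut.conj (g z hz) ^ k) = _
    rw [map_mul, map_pow, map_pow, map_inv, map_inv, inv_inv]
  rw [e]
  exact mul_mem (pow_mem hfrob i) (pow_mem (inv_mem hconj) k)

/-- A permutation that preserves orthogonality, fixes `1` and normalizes `C` is an automorphism of
both unitals, up to conjugation by `f` and inversion. -/
theorem exists_decomposition [Finite F] (ψ : Equiv.Perm SL(2, F))
    (hψ : ∀ x y, Perp (ψ x) (ψ y) ↔ Perp x y) (h1 : ψ 1 = 1) (hg : ψ (g z hz) ∈ C z hz) :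
    ∃ κ h : Equiv.Perm SL(2, F), h ∈ (OU z hz).Aut ⊓ (PU z hz).Aut ∧ ψ = h.trans κ ∧
      (κ = 1 ∨ (∀ x, κ x = MulAut.conj (f F) x) ∨ (∀ x, κ x = x⁻¹) ∨
        ∀ x, κ x = (MulAut.conj (f F) x)⁻¹) := by
  rcases map_mul_or_map_mul_rev ψ hψ h1 with hm | hm
  · obtain ⟨i, j, k, hj, h⟩ := eq_of_map_mul hz hF ψ hψ hm hg
    refine ⟨(MulAut.conj (f F) ^ j).toEquiv, _, toPerm_mem_Aut_inf hz hF i k,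
      Equiv.ext fun x => h x, ?_⟩
    obtain rfl | rfl : j = 0 ∨ j = 1 := by omega
    · exact Or.inl rfl
    · exact Or.inr (Or.inl fun x => by rw [pow_one]; rfl)
  -- Inversion turns the antiautomorphism into an automorphism and preserves both orthogonality and
  -- `C`.
  · obtain ⟨i, j, k, hj, h⟩ := eq_of_map_mul hz hF (ψ.trans (Equiv.inv _))
      (fun x y => (perp_inv _ _).trans (hψ x y)) (fun x y => by simp [hm])
      ((C z hz).inv_mem hg)
    refine ⟨(MulAut.conj (f F) ^ j).toEquiv.trans (Equiv.inv _), _, toPerm_mem_Aut_inf hz hF i k,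
      Equiv.ext fun x => ?_, ?_⟩
    · have h2 := h x
      change (ψ x)⁻¹ = _ at h2
      rw [← inv_inv (ψ x), h2]
      rfl
    · obtain rfl | rfl : j = 0 ∨ j = 1 := by omega
      · exact Or.inr (Or.inr (Or.inl fun x => rfl))
      · exact Or.inr (Or.inr (Or.inr fun x => by rw [pow_one]; rfl))

/-- Every isomorphism between two of the unitals is an automorphism of both. -/
theorem mem_Aut_of_isIsomorphism [Finite F] {𝒟 𝒟' : Set (Set SL(2, F))}
    (h𝒟 : 𝒟 = 𝒟O z hz ∨ 𝒟 = 𝒟P z hz) (h𝒟' : 𝒟' = 𝒟O z hz ∨ 𝒟' = 𝒟P z hz)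
    {ψ : Equiv.Perm SL(2, F)}
    (hψ : (unital 2 (C z hz) 𝒟).IsIsomorphism (unital 2 (C z hz) 𝒟') ψ) :
    ψ ∈ (OU z hz).Aut ⊓ (PU z hz).Aut := by
  have hr : ∀ a, Equiv.mulRight a ∈ (OU z hz).Aut ⊓ (PU z hz).Aut :=
    fun a => ⟨mulRight_mem_Aut _ _ _ a, mulRight_mem_Aut _ _ _ a⟩
  have haff : ∀ {𝒟}, 𝒟 = 𝒟O z hz ∨ 𝒟 = 𝒟P z hz → IsAffineUnital 2 (C z hz) 𝒟 := by
    rintro 𝒟 (rfl | rfl)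
    · exact isAffineUnital_O hz hF
    · exact isAffineUnital_P hz hF
  have hinf : ∀ {𝒟}, 𝒟 = 𝒟O z hz ∨ 𝒟 = 𝒟P z hz → ∀ {χ : Equiv.Perm SL(2, F)},
      χ ∈ (OU z hz).Aut ⊓ (PU z hz).Aut → χ ∈ (unital 2 (C z hz) 𝒟).Aut := by
    rintro 𝒟 (rfl | rfl) χ h
    · exact h.1
    · exact h.2
  have hnot : ∀ l, (∀ x ∈ l, x.det = K8.X 0) → M8.NotBlock l (M8.listsO ++ M8.listsP) →
      toSet z l ∉ (unital 2 (C z hz) 𝒟').blocks := by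
    intro l hl h
    rcases h𝒟' with rfl | rfl
    · rw [𝒟O_eq hz hF]
      exact toSet_notMem_blocks hz hF hl (fun l' hl' => (M8.listsO_facts l' hl').2.2.2)
        (h.mono (List.subset_append_left _ _))
    · rw [𝒟P_eq hz hF]
      exact toSet_notMem_blocks hz hF hl (fun l' hl' => (M8.listsP_facts l' hl').2.2.2)
        (h.mono (List.subset_append_right _ _))
  have hD₁ : toSet z M8.listD₁ ∈ (unital 2 (C z hz) 𝒟).blocks := by
    refine ⟨1, Or.inr (Or.inr ⟨D₁ z, ?_, ?_⟩)⟩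
    · rcases h𝒟 with rfl | rfl <;> exact Set.mem_insert _ _
    · simp [rightTranslate, D₁_eq hz hF]
  -- Right translations are automorphisms of both unitals, so `1` may be assumed fixed.
  set ψ₀ : Equiv.Perm SL(2, F) := ψ.trans (Equiv.mulRight (ψ 1)⁻¹) with hψ₀
  have hiso : (unital 2 (C z hz) 𝒟).IsIsomorphism (unital 2 (C z hz) 𝒟') ψ₀ :=
    hψ.trans (mem_Aut_iff.1 (hinf h𝒟' (hr _)))
  have h1 : ψ₀ 1 = 1 := by simp [hψ₀]
  obtain ⟨κ, h, hh, hκh, hκ⟩ := exists_decomposition hz hF ψ₀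
    (perp_iff_of_isIsomorphism hF (haff h𝒟) (haff h𝒟') hiso) h1
    (map_mem_of_isIsomorphism hF (haff h𝒟) (haff h𝒟') hiso h1 (Subgroup.mem_zpowers _))
  have hκiso : (unital 2 (C z hz) 𝒟).IsIsomorphism (unital 2 (C z hz) 𝒟') κ := by
    have := (mem_Aut_iff.1 (hinf h𝒟 hh)).symm.trans hiso
    rwa [hκh, ← Equiv.trans_assoc, Equiv.symm_trans_self, Equiv.refl_trans] at this
  have hcf : ∀ x : SL(2, F), code z (MulAut.conj (f F) x) = M8.f * code z x * M8.f.adj := by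
    intro x
    rw [MulAut.conj_apply, code_mul hz hF, code_mul hz hF, code_inv hz hF, code_f hz hF]
  -- `D₁` is a block of both unitals, and its image under each nontrivial candidate is a block of
  -- neither, so one test serves every choice of source and target.
  have hκ1 : κ = 1 := by
    have hb := hκiso.image_mem hD₁
    rcases hκ with hκ | hκ | hκ | hκ
    · exact hκ
    · rw [image_toSet hz hF (m := fun x => M8.f * x * M8.f.adj)
        (fun x => by rw [hκ, hcf]) M8.det_listD₁] at hb
      exact absurd hb (hnot _ M8.det_conj_f M8.notBlock_conj_f)
    · rw [image_toSet hz hF (fun x => by rw [hκ, code_inv hz hF]) M8.det_listD₁] at hb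
      exact absurd hb (hnot _ M8.det_adj M8.notBlock_adj)
    · rw [image_toSet hz hF (m := fun x => (M8.f * x * M8.f.adj).adj)
        (fun x => by rw [hκ, code_inv hz hF, hcf]) M8.det_listD₁] at hb
      exact absurd hb (hnot _ M8.det_adj_conj_f M8.notBlock_adj_conj_f)
  have hmem : ψ₀ ∈ (OU z hz).Aut ⊓ (PU z hz).Aut := by
    rw [hκh, hκ1]
    exact hh
  have e : ψ = Equiv.mulRight (ψ 1) * ψ₀ := by
    ext1 x
    simp [hψ₀]
  rw [e]
  exact mul_mem (hr _) hmem

end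

end AffineSL2

theorem mainTheorem3 {F : Type*} [Field F] [CharP F 2] (hF : Nat.card F = 8)
    (z : F) (hz : z ^ 3 = z + 1) :
    AffineSL2.IsAffineUnital 2 (AffineSL2.C z hz) (AffineSL2.𝒟O z hz) ∧
    AffineSL2.IsAffineUnital 2 (AffineSL2.C z hz) (AffineSL2.𝒟P z hz) ∧
    ¬ (AffineSL2.OU z hz).Isomorphic (AffineSL2.PU z hz) ∧
    (AffineSL2.OU z hz).Aut = (AffineSL2.PU z hz).Aut := by
  have hfin : Finite F := Nat.finite_of_card_ne_zero (by rw [hF]; decide)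
  refine ⟨AffineSL2.isAffineUnital_O hz hF, AffineSL2.isAffineUnital_P hz hF, ?_, ?_⟩
  · rintro ⟨ψ, hψ⟩
    have h := AffineSL2.mem_Aut_of_isIsomorphism hz hF (Or.inl rfl) (Or.inr rfl) hψ
    -- `ψ` maps the blocks of the Osterunital both onto themselves and onto those of the
    -- Pfingstunital.
    have he : (AffineSL2.OU z hz).blocks = (AffineSL2.PU z hz).blocks :=
      Eq.trans (Eq.symm (IncidenceStructure.mem_Aut_iff.1 h.1)) hψ
    have hb : AffineSL2.toSet z AffineSL2.M8.listD₄ ∈ (AffineSL2.OU z hz).blocks := by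
      refine ⟨1, Or.inr (Or.inr ⟨AffineSL2.D₄ z, ?_, ?_⟩)⟩
      · simp [AffineSL2.𝒟O]
      · simp [AffineSL2.rightTranslate, AffineSL2.D₄_eq hz hF]
    rw [he, AffineSL2.PU, AffineSL2.𝒟P_eq hz hF] at hb
    exact AffineSL2.toSet_notMem_blocks hz hF AffineSL2.M8.det_listD₄
      (fun l hl => (AffineSL2.M8.listsP_facts l hl).2.2.2) AffineSL2.M8.notBlock_D₄ hb
  · ext ψ
    constructor
    · intro h
      exact (AffineSL2.mem_Aut_of_isIsomorphism hz hF (Or.inl rfl) (Or.inl rfl) h).2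
    · intro h
      exact (AffineSL2.mem_Aut_of_isIsomorphism hz hF (Or.inr rfl) (Or.inr rfl) h).1
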